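/- **Theorem (Iwasawa decomposition).** *Setting.* Let $V$ be a finite-dimensional real vector space and let $\Phi\subset V^*$ be a (finite, crystallographic, possibly non-reduced) root system, with coroots $\alpha^\vee\in V$ and reflections $r_\alpha(\beta)=\beta-\beta(\alpha^\vee)\alpha$. A *basis* of $\Phi$ is a linearly independent subset $\Delta\subset\Phi$ such that every root is a combination of elements of $\Delta$ with integer coefficients all $\ge 0$ or all $\le 0$; $\Phi_\Delta^+$ is the set of the roots with coefficients $\ge 0$. For $\alpha,\beta\in\Phi$ put $(\alpha,\beta)=\{r\alpha+s\beta\in\Phi : r,s\in\mathbb Z_{>0}\}$. Let $R$ be a totally ordered abelian group that is a $\mathbb Q$-module, $V_{\mathbb Z}=\sum_{\alpha\in\Phi}\mathbb Z\alpha^\vee$ and $V_R=V_{\mathbb Z}\otimes_{\mathbb Z}R$; each root $\alpha$ induces a map $\alpha:V_R\to R$, and each reflection a map $r_\alpha(v)=v-\alpha(v)\alpha^\vee$ of $V_R$. The *vector chambers* of $V_R$ are the sets $C_\Delta=\{v\in V_R:\alpha(v)>0\ \forall\alpha\in\Delta\}$, $\Delta$ a basis of $\Phi$. Let $\mathbb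 A$ be an affine space under $V_R$ with an origin $o$; write $\alpha(x)=\alpha(x-o)$ for $x\in\mathbb A$, and give $\mathbb A$ the topology generated by the sets $\{x:\alpha(x)+\lambda>0\}$ ($\alpha\in\Phi$, $\lambda\in R$). Let $\mathrm{Aff}_R(\mathbb A)$ be the group of the affine bijections of $\mathbb A$ whose linear part is $g\otimes\mathrm{id}_R$ for some $g\in \mathrm{GL}(V_{\mathbb Z})$. *Root group datum.* Let $G$ be a group with a root group datum $(T,(U_\alpha,M_\alpha)_{\alpha\in\Phi})$ of type $\Phi$: $T$ is a subgroup and the $U_\alpha$ are nontrivial subgroups of $G$; $[U_\alpha,U_\beta]\subset\langle U_\gamma:\gamma\in(\alpha,\beta)\rangle$ if $\beta\notin\mathbb R_{<0}\alpha$; $U_{2\alpha}\subsetneq U_\alpha$ if $\alpha,2\alpha\in\Phi$; each $M_\alpha$ is a right coset $Tm$ of $T$, and $U_{-\alpha}\setminus\{1\}\subset U_\alpha M_\alpha U_\alpha$; $mU_\beta m^{-1}=U_{r_\alpha(\beta)}$ for $m\in M_\alpha$; and, for every basis $\Delta$, $TU^+\cap U^-=\{1\}$ where $U^{\pm}=\langle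 U_{\pm\alpha}:\alpha\in\Phi^+_\Delta\rangle$. Assume that it is *generating*: $G$ is generated by $T$ and the $U_\alpha$. Let $N$ be the subgroup generated by $T$ and the $M_\alpha$ (that is, by the $M_\alpha$ if $\Phi\neq\emptyset$, and $N=T$ otherwise). *Valuation.* Let $(\varphi_\alpha:U_\alpha\to R\cup\{\infty\})_{\alpha\in\Phi}$ be an $R$-valuation of the datum, i.e., with $U_{\alpha,\lambda}=\{u\in U_\alpha:\varphi_\alpha(u)\ge\lambda\}$: $\varphi_\alpha(U_\alpha)$ has at least $3$ elements; $U_{\alpha,\lambda}$ is a subgroup for every $\lambda\in R\cup\{\infty\}$, and $U_{\alpha,\infty}=\{1\}$; for $m\in M_\alpha$ the map $u\mapsto\varphi_{-\alpha}(u)-\varphi_\alpha(mum^{-1})$ is constant on $U_{-\alpha}\setminus\{1\}$; for $\beta\notin\mathbb R_{\le0}\alpha$ and $\lambda,\mu\in R$, $[U_{\alpha,\lambda},U_{\beta,\mu}]$ lies in the group generated by the $U_{r\alpha+s\beta,r\lambda+s\mu}$ for $r,s\in\mathbb Z_{>0}$ with $r\alpha+s\beta\in\Phi$; $\varphi_{2\alpha}=2\varphi_\alpha|_{U_{2\alpha}}$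 if $\alpha,2\alpha\in\Phi$; and $\varphi_{-\alpha}(u')=-\varphi_\alpha(u)$ whenever $u\in U_\alpha$, $u',u''\in U_{-\alpha}$ and $u'uu''\in M_\alpha$. *Compatible action.* Let $\nu:N\to\mathrm{Aff}_R(\mathbb A)$ be a homomorphism such that the linear part of $\nu$ is the homomorphism $N\to W(\Phi)$ that sends every $m\in M_\alpha$ to $r_\alpha$, and such that $2\varphi_\alpha(u)+\alpha(\nu(m(u))(o)-o)=0$ for all $\alpha\in\Phi$ and $u\in U_\alpha\setminus\{1\}$, where $m(u)$ is the unique element of $M_\alpha\cap U_{-\alpha}uU_{-\alpha}$. Put $T_b=\ker\nu$ and $W^{\mathrm{aff}}=\nu(N)$. *Parahoric subgroups.* For $\Omega\subset\mathbb A$ let $\widehat P_\Omega$ be the subgroup of $G$ generated by the sets $\{u\in U_\alpha:\varphi_\alpha(u)\ge-\alpha(x)\ \forall x\in\Omega\}$ ($\alpha\in\Phi$) and $\{n\in N:\nu(n)(x)=x\ \forall x\in\Omega\}$; for a filter $\mathcal V$ on $\mathbb A$ let $\widehat P_{\mathcal V}=\bigcup_{\Omega\in\mathcal V}\widehat P_\Omega$.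 For a vector chamber $C$ and $x\in\mathbb A$ let $\mathcal F_{x,C}$ be the germ of $x+C$ at $x$, i.e. the filter generated by the sets $\Omega\cap(x+C)$ with $\Omega$ a neighbourhood of $x$; and let $U_C$ be the subgroup generated by the $U_\alpha$ with $\alpha>0$ on $C$. *Statement.* Let $C$ and $C'$ be vector chambers of $V_R$, $x\in\mathbb A$ and $\mathcal F=\mathcal F_{x,C}$. Then $$G=U_{C'}\,N\,\widehat P_{\mathcal F},$$ and $n\mapsto U_{C'}\,n\,\widehat P_{\mathcal F}$ induces bijections $$W^{\mathrm{aff}}\cong N/T_b\;\longrightarrow\;U_{C'}\backslash G/\widehat P_{\mathcal F}.$$ -/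

import Mathlib

open scoped TensorProduct Pointwise

noncomputable section

namespace Iwasawa

universe u₁ u₂ u₃ u₄ u₅ u₆

/-! ### Root systems -/

section Roots

variable {ι : Type u₁} {M : Type u₂} {V : Type u₃}
  [AddCommGroup M] [Module ℝ M] [AddCommGroup V] [Module ℝ V] (P : RootPairing ι ℝ M V)

/-- The index of the opposite root `-α`. -/
def neg (α : ι) : ι := P.reflectionPerm α α

/-- A basis `Δ` of the (possibly non-reduced) root system: a linearly independent set of roots such
that every root is a combination of elements of `Δ` with integer coefficients, either all
nonnegative or all nonpositive. (`RootPairing.Base` also constrains the coroots, and does not exist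
for non-reduced root systems.) -/
structure IsBasis (Δ : Set ι) : Prop where
  linearIndepOn : LinearIndepOn ℝ P.root Δ
  mem_or_neg_mem (α : ι) : P.root α ∈ AddSubmonoid.closure (P.root '' Δ) ∨
    -P.root α ∈ AddSubmonoid.closure (P.root '' Δ)

/-- The set `Φ_Δ⁺` of the roots that are combinations of elements of `Δ` with nonnegative integer
coefficients. -/
def posRoots (Δ : Set ι) : Set ι := {α | P.root α ∈ AddSubmonoid.closure (P.root '' Δ)}

/-- The set `(α, β)` of the roots `r α + s β` with positive integers `r` and `s`. -/
def openInterval (α β : ι) : Set ι :=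
  {γ | ∃ r s : ℕ, 0 < r ∧ 0 < s ∧ P.root γ = r • P.root α + s • P.root β}

end Roots

/-! ### The vectorial apartment `V_R` and `R`-aff spaces -/

section Apartment

variable {ι : Type u₁} {M : Type u₂} {V : Type u₃}
  [AddCommGroup M] [Module ℝ M] [AddCommGroup V] [Module ℝ V] (P : RootPairing ι ℝ M V)

/-- `V_ℤ`, the `ℤ`-module spanned by the coroots. -/
abbrev VZ : Type u₃ := P.corootSpan ℤ

/-- `V_R = V_ℤ ⊗ R`. -/
abbrev VR (R : Type u₄) [AddCommGroup R] : Type (max u₃ u₄) := VZ P ⊗[ℤ] R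

variable (R : Type u₄) [AddCommGroup R]

/-- The map `V_R → R` induced by the root `α`, `v ⊗ r ↦ α(v) r`. -/
def rootMap [P.IsCrystallographic] (α : ι) : VR P R →+ R :=
  (TensorProduct.lid ℤ R).toAddMonoidHom.comp
    (LinearMap.rTensor R (P.root'In ℤ α)).toAddMonoidHom

/-- The reflection `r_α` on `V_R`: the map `v ↦ v - α(v) α^∨` on `V_ℤ`, tensored with `R`. -/
def reflectionMap [P.IsCrystallographic] (α : ι) : VR P R →+ VR P R :=
  (LinearMap.rTensor R
    (Module.preReflection (P.corootSpanMem ℤ α) (P.root'In ℤ α))).toAddMonoidHom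

/-- `C_Δ`, the set of the `v` in `V_R` with `α(v) > 0` for all `α` in `Δ`. -/
def chamber [P.IsCrystallographic] [LinearOrder R] (Δ : Set ι) : Set (VR P R) :=
  {v | ∀ α ∈ Δ, 0 < rootMap P R α v}

/-- The vector chambers of `V_R` are the `C_Δ` for the bases `Δ` of the root system. -/
def IsVectorChamber [P.IsCrystallographic] [LinearOrder R] (C : Set (VR P R)) : Prop :=
  ∃ Δ : Set ι, IsBasis P Δ ∧ C = chamber P R Δ

/-- `Φ_C⁺`, the set of the roots that are positive on the subset `C` of `V_R`. -/
def rootsPosOn [P.IsCrystallographic] [LinearOrder R] (C : Set (VR P R)) : Set ι :=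
  {α | ∀ v ∈ C, 0 < rootMap P R α v}

variable (A : Type u₅) [AddTorsor (VR P R) A]

/-- The group `Aff_R(A)` of the affine bijections of `A` whose linear part is `g ⊗ id_R` for some
`g ∈ GL(V_ℤ)`. -/
def affGroup : Subgroup (Equiv.Perm A) where
  carrier := {f | ∃ g : VZ P ≃ₗ[ℤ] VZ P, ∀ (v : VR P R) (x : A),
    f (v +ᵥ x) = LinearMap.rTensor R g.toLinearMap v +ᵥ f x}
  mul_mem' := by
    rintro f₁ f₂ ⟨g₁, h₁⟩ ⟨g₂, h₂⟩
    refine ⟨g₂.trans g₁, fun v x => ?_⟩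
    rw [LinearEquiv.coe_trans, LinearMap.rTensor_comp_apply, Equiv.Perm.mul_apply, h₂, h₁]
    rfl
  one_mem' := ⟨LinearEquiv.refl ℤ _, fun v x => by
    rw [LinearEquiv.refl_toLinearMap, LinearMap.rTensor_id]; rfl⟩
  inv_mem' := by
    rintro f ⟨g, h⟩
    refine ⟨g.symm, fun v x => ?_⟩
    rw [Equiv.Perm.inv_eq_iff_eq, h, ← LinearMap.rTensor_comp_apply]
    simp

variable {A} [P.IsCrystallographic]

/-- `α(x) = α(x - o)` for a point `x` of `A`. -/
def rootAt (o : A) (α : ι) (x : A) : R := rootMap P R α (x -ᵥ o)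

variable [LinearOrder R]

/-- The topology of `A`, generated by the open half-spaces `{x | α(x - o) + r > 0}`. -/
@[reducible]
def apartmentTopology (o : A) : TopologicalSpace A :=
  TopologicalSpace.generateFrom {D | ∃ (α : ι) (r : R), D = {x | 0 < rootAt P R o α x + r}}

/-- The germ of `x + C` at `x`: the filter generated by the sets `Ω ∩ (x + C)` for the
neighbourhoods `Ω` of `x`. -/
def germ (o x : A) (C : Set (VR P R)) : Filter A :=
  @nhds A (apartmentTopology P R o) x ⊓ Filter.principal ((fun v => v +ᵥ x) '' C)

end Apartment

/-! ### Root group data and their valuations -/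

section Groups

variable {ι : Type u₁} {M : Type u₂} {V : Type u₃}
  [AddCommGroup M] [Module ℝ M] [AddCommGroup V] [Module ℝ V]

/-- A root group datum `(T, (U_α, M_α))` of type `Φ` of a group `G`. -/
structure RootGroupDatum (P : RootPairing ι ℝ M V) (G : Type u₆) [Group G] where
  T : Subgroup G
  U : ι → Subgroup G
  M : ι → Set G
  U_ne_bot (α : ι) : U α ≠ ⊥
  commutator_le (α β : ι) (h : ∀ c : ℝ, c < 0 → P.root β ≠ c • P.root α) :
    ⁅U α, U β⁆ ≤ ⨆ γ ∈ openInterval P α β, U γ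
  U_two_lt (α γ : ι) (h : P.root γ = 2 • P.root α) : U γ < U α
  M_coset (α : ι) : ∃ m : G, M α = (T : Set G) * {m}
  U_neg_subset (α : ι) :
    (U (neg P α) : Set G) \ {1} ⊆ (U α : Set G) * M α * (U α : Set G)
  conj_U (α β : ι) (m : G) (hm : m ∈ M α) :
    (U β).map (MulAut.conj m).toMonoidHom = U (P.reflectionPerm α β)
  inter_eq (Δ : Set ι) (hΔ : IsBasis P Δ) :
    ((T : Set G) * ((⨆ α ∈ posRoots P Δ, U α : Subgroup G) : Set G)) ∩
      ((⨆ α ∈ posRoots P Δ, U (neg P α) : Subgroup G) : Set G) = {1}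

namespace RootGroupDatum

variable {P : RootPairing ι ℝ M V} {G : Type u₆} [Group G] (D : RootGroupDatum P G)

/-- The root group datum is generating if `T` and the `U_α` generate `G`. -/
def IsGenerating : Prop := Subgroup.closure ((D.T : Set G) ∪ ⋃ α, (D.U α : Set G)) = ⊤

/-- The group `N` generated by `T` and the `M_α`. If there is at least one root, it is generated by
the `M_α`, which are cosets of `T`; otherwise it is `T`. -/
def N : Subgroup G := Subgroup.closure ((D.T : Set G) ∪ ⋃ α, D.M α)

lemma mem_N {α : ι} {m : G} (hm : m ∈ D.M α) : m ∈ D.N :=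
  Subgroup.subset_closure (Or.inr (Set.mem_iUnion.2 ⟨α, hm⟩))

variable (R : Type u₄) [AddCommGroup R] [LinearOrder R]

/-- The set `{u ∈ U_α | φ(u) ≥ r}` for a map `φ` on `U_α`. -/
def level {α : ι} (φ : D.U α → WithTop R) (r : WithTop R) : Set G :=
  {g | ∃ h : g ∈ D.U α, r ≤ φ ⟨g, h⟩}

/-- An `R`-valuation `(φ_α)` of the root group datum. -/
structure Valuation where
  φ (α : ι) : D.U α → WithTop R
  three_le (α : ι) : 3 ≤ (Set.range (φ α)).encard
  level_subgroup (α : ι) (r : WithTop R) : ∃ H : Subgroup G, (H : Set G) = D.level R (φ α) r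
  level_top (α : ι) : D.level R (φ α) ⊤ = {1}
  /-- For `m ∈ M_α`, the map `u ↦ φ_{-α}(u) - φ_α(m u m⁻¹)` is constant on `U_{-α} \ {1}`. -/
  sub_const (α : ι) (m : G) (hm : m ∈ D.M α) :
    ∃ c : R, ∀ (u : D.U (neg P α)) (v : D.U α), u ≠ 1 → (v : G) = m * u * m⁻¹ →
      φ (neg P α) u = φ α v + (c : WithTop R)
  /-- `[U_{α,a}, U_{β,b}]` is contained in the group generated by the `U_{rα+sβ,ra+sb}`. -/
  commutator_mem (α β : ι) (h : ∀ c : ℝ, c ≤ 0 → P.root β ≠ c • P.root α) (a b : R) (x y : G)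
    (hx : x ∈ D.level R (φ α) a) (hy : y ∈ D.level R (φ β) b) :
    x * y * x⁻¹ * y⁻¹ ∈ Subgroup.closure {g : G | ∃ (r s : ℕ) (γ : ι), 0 < r ∧ 0 < s ∧
      P.root γ = r • P.root α + s • P.root β ∧
      g ∈ D.level R (φ γ) ((r • a + s • b : R) : WithTop R)}
  two_smul (α γ : ι) (h : P.root γ = 2 • P.root α) (u : G) (hγ : u ∈ D.U γ) (hα : u ∈ D.U α) :
    φ γ ⟨u, hγ⟩ = 2 • φ α ⟨u, hα⟩
  /-- If `u' u u'' ∈ M_α`, then `φ_{-α}(u') = -φ_α(u)`, the two values being finite. -/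
  add_eq_zero (α : ι) (u : D.U α) (u' u'' : D.U (neg P α))
    (h : (u' : G) * u * u'' ∈ D.M α) : φ (neg P α) u' + φ α u = 0

variable {R} {D}
variable [P.IsCrystallographic] {A : Type u₅} [AddTorsor (VR P R) A]

/-- The action `ν` of `N` on the `R`-aff space `A` with origin `o` is compatible with the valuation.

The first condition says that the linear part of `ν` is the homomorphism `N → W(Φ)` that maps
the elements of `M_α` to `r_α` for every root `α`; since `N` is generated by the `M_α` as soon as
there is a root, it has to be required only on the `M_α`.

The second condition says that `2 φ_α(u) + α(ν(m(u))(o) - o) = 0` for `u ∈ U_α \ {1}`, where `m(u)`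
is the element of `M_α` of the form `u' u u''` with `u', u'' ∈ U_{-α}`. -/
structure IsCompatible (φ : D.Valuation R) (o : A) (ν : D.N →* affGroup P R A) : Prop where
  linear_eq (α : ι) (m : G) (hm : m ∈ D.M α) (v : VR P R) (x : A) :
    (ν ⟨m, D.mem_N hm⟩ : Equiv.Perm A) (v +ᵥ x) =
      reflectionMap P R α v +ᵥ (ν ⟨m, D.mem_N hm⟩ : Equiv.Perm A) x
  two_smul_add (α : ι) (u : D.U α) (hu : u ≠ 1) (u' u'' : D.U (neg P α))
    (h : (u' : G) * u * u'' ∈ D.M α) :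
    2 • φ.φ α u +
      ((rootAt P R o α ((ν ⟨u' * u * u'', D.mem_N h⟩ : Equiv.Perm A) o) : R) : WithTop R) = 0

/-- The group `U_C` generated by the `U_α` for the roots `α` that are positive on `C`. -/
def chamberGroup (D : RootGroupDatum P G) (C : Set (VR P R)) : Subgroup G :=
  ⨆ α ∈ rootsPosOn P R C, D.U α

/-- The group `U_Ω` generated by the `U_{α,Ω} = {u ∈ U_α | ∀ x ∈ Ω, φ_α(u) ≥ -α(x)}`. -/
def unipotent (φ : D.Valuation R) (o : A) (Ω : Set A) : Subgroup G :=
  Subgroup.closure {g | ∃ (α : ι) (h : g ∈ D.U α), ∀ x ∈ Ω,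
    ((-rootAt P R o α x : R) : WithTop R) ≤ φ.φ α ⟨g, h⟩}

/-- The set of the elements of `N` that fix `Ω` pointwise. -/
def fixator (ν : D.N →* affGroup P R A) (Ω : Set A) : Set G :=
  {g | ∃ h : g ∈ D.N, ∀ x ∈ Ω, (ν ⟨g, h⟩ : Equiv.Perm A) x = x}

/-- The parahoric subgroup of a set `Ω`, generated by `U_Ω` and the fixator of `Ω` in `N`. -/
def parahoric (φ : D.Valuation R) (o : A) (ν : D.N →* affGroup P R A) (Ω : Set A) :
    Subgroup G :=
  Subgroup.closure ((unipotent φ o Ω : Set G) ∪ fixator ν Ω)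

lemma parahoric_anti (φ : D.Valuation R) (o : A) (ν : D.N →* affGroup P R A) {Ω Ω' : Set A}
    (h : Ω' ⊆ Ω) : parahoric φ o ν Ω ≤ parahoric φ o ν Ω' := by
  refine Subgroup.closure_mono (Set.union_subset_union ?_ ?_)
  · refine Subgroup.closure_mono ?_
    rintro g ⟨α, hg, H⟩
    exact ⟨α, hg, fun x hx => H x (h hx)⟩
  · rintro g ⟨hg, H⟩
    exact ⟨hg, fun x hx => H x (h hx)⟩

/-- The parahoric subgroup of a filter, the union of those of the members of the filter. -/
def parahoricFilter (φ : D.Valuation R) (o : A) (ν : D.N →* affGroup P R A) (F : Filter A) :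
    Subgroup G where
  carrier := ⋃ Ω ∈ F, (parahoric φ o ν Ω : Set G)
  mul_mem' := by
    intro a b ha hb
    simp only [Set.mem_iUnion] at ha hb ⊢
    obtain ⟨Ω, hΩ, ha⟩ := ha
    obtain ⟨Ω', hΩ', hb⟩ := hb
    exact ⟨Ω ∩ Ω', Filter.inter_mem hΩ hΩ',
      mul_mem (parahoric_anti φ o ν Set.inter_subset_left ha)
        (parahoric_anti φ o ν Set.inter_subset_right hb)⟩
  one_mem' := by
    simp only [Set.mem_iUnion]
    exact ⟨Set.univ, Filter.univ_mem, one_mem _⟩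
  inv_mem' := by
    intro a ha
    simp only [Set.mem_iUnion] at ha ⊢
    obtain ⟨Ω, hΩ, ha⟩ := ha
    exact ⟨Ω, hΩ, inv_mem ha⟩

end RootGroupDatum

end Groups

end Iwasawa

end

open scoped TensorProduct Pointwise

noncomputable section

namespace Iwasawa

universe u₁ u₂ u₃ u₄ u₅ u₆

/-! ### Bases of root systems -/

section Bases

variable {ι : Type u₁} {M : Type u₂} {V : Type u₃}
  [AddCommGroup M] [Module ℝ M] [AddCommGroup V] [Module ℝ V] (P : RootPairing ι ℝ M V)

/-! Both halves of the theorem use one device: a product set attached to a positive system is shown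
to be independent of that system by crossing one simple reflection at a time (`IsBasis.gallery`).
Since `U⁺` is the product of `U_α`, `α` simple, and of the group generated by the root groups of the
positive roots outside `{α, 2α}`, which stay positive after `r_α`, each crossing reduces to a
rank-one statement about `U_α` and `U_{-α}`.

Existence. Let `Q` be the parahoric subgroup of the germ. An element `y ≠ 1` of `U_β` is `a m b`
with `a, b ∈ U_{-β}`, `m ∈ M_β` and `φ_{-β}(b) = -φ_β(y)`. The opposite signs force `y` or `b` into
`Q`, so `y` lies in `Q` or in `U_{-β} M_β Q` (`mem_parahoricFilter_or`). Hence `U_Δ N Q` does not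
depend on `Δ`. Every root is positive for `Δ` or for `-Δ`, so this set is stable under left
multiplication by all root groups and by `T`, and it is `G` (`mem_iwasawaCell`).

Injectivity. Every member `Ω` of the germ contains two points with regular difference. For such an
`Ω`, the parahoric subgroup is `U_Ω⁺ U_Ω⁻ T_b` for every positive system
(`mem_bigCell_of_mem_parahoric`). The rank-one input is `exists_mul_eq`: if `φ_α(u) + φ_{-α}(v) >
0`, then `u v = v' t u'` with unchanged valuations and `t` acting trivially. If `n` and `n'` have
the same double coset, then `u n⁻¹ n'` is in the parahoric subgroup for some `u` in some `U⁺`.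
Comparison with `a b t` puts `n⁻¹ n' t⁻¹` in `N ∩ U⁺ U⁻`, which is trivial.

Two facts need work. First, `N ∩ U⁺ U⁻ = 1` (`eq_one_of_eq_mul`) holds because an element of `N`
that preserves the positive roots is in `T`, by the exchange condition. Second, `t` above acts
trivially: it preserves differences of points, the `α`-component of its displacement vanishes by
computation, and for another simple root `β` conjugation by `t` and by `t⁻¹` preserves the
filtration of `U_β` (`conj_mem_lev`), which kills the `β`-component. -/

@[simp] lemma root_neg (α : ι) : P.root (neg P α) = -P.root α := by
  rw [neg, P.root_reflectionPerm, P.reflection_apply_self]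

@[simp] lemma neg_neg_index (α : ι) : neg P (neg P α) = α := by
  apply P.root.injective; simp

/-- A permutation of the roots induced by a linear automorphism. -/
def IsAut (w : Equiv.Perm ι) : Prop := ∃ f : M ≃ₗ[ℝ] M, ∀ γ, P.root (w γ) = f (P.root γ)

/-- The permutation `α ↦ -α` of the roots. -/
def negPerm : Equiv.Perm ι := Function.Involutive.toPerm (neg P) (neg_neg_index P)

@[simp] lemma negPerm_apply (α : ι) : negPerm P α = neg P α := rfl

lemma isAut_negPerm : IsAut P (negPerm P) := ⟨LinearEquiv.neg ℝ, fun γ => by simp⟩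

lemma isAut_reflectionPerm (α : ι) : IsAut P (P.reflectionPerm α) :=
  ⟨P.reflection α, fun γ => P.root_reflectionPerm α γ⟩

lemma isAut_one : IsAut P 1 := ⟨LinearEquiv.refl ℝ M, fun _ => rfl⟩

variable {P}

lemma IsAut.mul {w w' : Equiv.Perm ι} (h : IsAut P w) (h' : IsAut P w') : IsAut P (w * w') := by
  obtain ⟨f, hf⟩ := h
  obtain ⟨f', hf'⟩ := h'
  exact ⟨f'.trans f, fun γ => by simp [hf, hf']⟩

lemma IsAut.inv {w : Equiv.Perm ι} (h : IsAut P w) : IsAut P w⁻¹ := by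
  obtain ⟨f, hf⟩ := h
  refine ⟨f.symm, fun γ => ?_⟩
  rw [LinearEquiv.eq_symm_apply, ← hf]
  simp

lemma IsAut.neg_apply {w : Equiv.Perm ι} (h : IsAut P w) (γ : ι) : w (neg P γ) = neg P (w γ) := by
  obtain ⟨f, hf⟩ := h
  apply P.root.injective
  simp [hf]

lemma IsAut.two_smul {w : Equiv.Perm ι} (h : IsAut P w) {α γ : ι}
    (hγ : P.root γ = 2 • P.root α) : P.root (w γ) = 2 • P.root (w α) := by
  obtain ⟨f, hf⟩ := h
  rw [hf, hf, hγ, map_nsmul]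

lemma IsAut.root_image {w : Equiv.Perm ι} {f : M ≃ₗ[ℝ] M} (hf : ∀ γ, P.root (w γ) = f (P.root γ))
    (Δ : Set ι) (x : M) : f x ∈ AddSubmonoid.closure (P.root '' (w '' Δ)) ↔
      x ∈ AddSubmonoid.closure (P.root '' Δ) := by
  have : P.root '' (w '' Δ) = f.toAddEquiv.toAddMonoidHom '' (P.root '' Δ) := by
    simp only [Set.image_image]
    exact Set.image_congr fun γ _ => hf γ
  rw [this, ← AddMonoidHom.map_mclosure]
  exact AddSubmonoid.mem_map_iff_mem (f := f.toAddEquiv.toAddMonoidHom) f.injective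

lemma IsAut.mem_posRoots_image {w : Equiv.Perm ι} (h : IsAut P w) {Δ : Set ι} {γ : ι} :
    w γ ∈ posRoots P (w '' Δ) ↔ γ ∈ posRoots P Δ := by
  obtain ⟨f, hf⟩ := h
  rw [posRoots, posRoots, Set.mem_ofPred, Set.mem_ofPred, hf, IsAut.root_image hf]

lemma IsAut.posRoots_image {w : Equiv.Perm ι} (h : IsAut P w) (Δ : Set ι) :
    posRoots P (w '' Δ) = w '' posRoots P Δ := by
  ext γ
  obtain ⟨γ, rfl⟩ := w.surjective γ
  rw [h.mem_posRoots_image, w.injective.mem_set_image]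

lemma IsAut.isBasis_image {w : Equiv.Perm ι} (h : IsAut P w) {Δ : Set ι} (hΔ : IsBasis P Δ) :
    IsBasis P (w '' Δ) := by
  obtain ⟨f, hf⟩ := h
  refine ⟨?_, fun γ => ?_⟩
  · have h1 : LinearIndepOn ℝ (f ∘ P.root) Δ :=
      hΔ.linearIndepOn.map_injOn f.toLinearMap f.injective.injOn
    have h2 : (f ∘ P.root : ι → M) = P.root ∘ w := funext fun γ => (hf γ).symm
    rw [h2] at h1
    exact h1.image_of_comp
  · obtain ⟨γ, rfl⟩ := w.surjective γ
    rw [hf, ← map_neg, IsAut.root_image hf, IsAut.root_image hf]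
    exact hΔ.mem_or_neg_mem γ

/-- The roots `α` and `2α`. -/
def ray (P : RootPairing ι ℝ M V) (α : ι) : Set ι := {γ | γ = α ∨ P.root γ = 2 • P.root α}

variable (P) in
lemma self_mem_ray (α : ι) : α ∈ ray P α := Or.inl rfl

lemma IsAut.mem_ray {w : Equiv.Perm ι} (h : IsAut P w) {α γ : ι} (hγ : γ ∈ ray P α) :
    w γ ∈ ray P (w α) := by
  rcases hγ with rfl | hγ
  · exact self_mem_ray P _
  · exact Or.inr (h.two_smul hγ)

lemma reflectionPerm_eq_neg_of_mem_ray {α γ : ι} (hγ : γ ∈ ray P α) :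
    P.reflectionPerm α γ = neg P γ := by
  rcases hγ with rfl | hγ
  · rfl
  · apply P.root.injective
    rw [P.root_reflectionPerm, hγ, map_nsmul, P.reflection_apply_self, root_neg, hγ, smul_neg]

lemma neg_mem_ray {α γ : ι} (hγ : γ ∈ ray P α) : neg P γ ∈ ray P (neg P α) :=
  (isAut_negPerm P).mem_ray hγ

/-! ### Coordinates of roots with respect to a basis. -/

section Coord

variable {Δ : Set ι} (hΔ : IsBasis P Δ)
include hΔ

/-- The dual functional is defined on the span of `Δ` and extended arbitrarily to `M`; only its
values on combinations of `Δ` matter. -/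
lemma IsBasis.exists_coord (δ : Δ) : ∃ f : M →ₗ[ℝ] ℝ, f (P.root δ) = 1 ∧
    ∀ δ' : Δ, δ' ≠ δ → f (P.root δ') = 0 := by
  have h : LinearIndependent ℝ (fun i : Δ => P.root i) := hΔ.linearIndepOn
  obtain ⟨g, hg⟩ := LinearMap.exists_extend ((Finsupp.lapply δ) ∘ₗ h.repr)
  have key (δ' : Δ) : g (P.root δ') = (Finsupp.single δ' (1 : ℝ)) δ := by
    have hm : P.root δ' ∈ Submodule.span ℝ (Set.range fun i : Δ => P.root i) :=
      Submodule.subset_span ⟨δ', rfl⟩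
    have := LinearMap.congr_fun hg ⟨P.root δ', hm⟩
    rw [LinearMap.comp_apply, Submodule.subtype_apply] at this
    rw [this, LinearMap.comp_apply, h.repr_eq_single δ' ⟨P.root δ', hm⟩ rfl]
    rfl
  refine ⟨g, by simp [key], fun δ' hδ' => ?_⟩
  rw [key, Finsupp.single_eq_of_ne hδ'.symm]

/-- The coordinate functional of an element of a basis. -/
def IsBasis.coord (δ : Δ) : M →ₗ[ℝ] ℝ := (hΔ.exists_coord δ).choose

@[simp] lemma IsBasis.coord_self (δ : Δ) : hΔ.coord δ (P.root δ) = 1 :=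
  (hΔ.exists_coord δ).choose_spec.1

lemma IsBasis.coord_of_ne {δ δ' : Δ} (h : δ' ≠ δ) : hΔ.coord δ (P.root δ') = 0 :=
  (hΔ.exists_coord δ).choose_spec.2 δ' h

lemma IsBasis.coord_nonneg_of_mem (δ : Δ) {x : M} (hx : x ∈ AddSubmonoid.closure (P.root '' Δ)) :
    0 ≤ hΔ.coord δ x := by
  induction hx using AddSubmonoid.closure_induction with
  | mem x h =>
    obtain ⟨δ', h, rfl⟩ := h
    by_cases hd : (⟨δ', h⟩ : Δ) = δ
    · subst hd; simp [hΔ.coord_self ⟨δ', h⟩]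
    · exact (hΔ.coord_of_ne hd).ge
  | zero => simp
  | add x y _ _ hx hy => rw [map_add]; positivity

lemma IsBasis.eq_zero_or_coord_pos {x : M} (hx : x ∈ AddSubmonoid.closure (P.root '' Δ)) :
    x = 0 ∨ ∃ δ : Δ, 0 < hΔ.coord δ x := by
  induction hx using AddSubmonoid.closure_induction with
  | mem x h =>
    obtain ⟨δ', h, rfl⟩ := h
    exact Or.inr ⟨⟨δ', h⟩, by simp [hΔ.coord_self ⟨δ', h⟩]⟩
  | zero => simp
  | add x y hx' hy' hx hy =>
    rcases hx with rfl | ⟨δ, hδ⟩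
    · simpa using hy
    · refine Or.inr ⟨δ, ?_⟩
      rw [map_add]
      exact add_pos_of_pos_of_nonneg hδ (hΔ.coord_nonneg_of_mem δ hy')

lemma IsBasis.multiple_or_coord_pos (α : Δ) {x : M}
    (hx : x ∈ AddSubmonoid.closure (P.root '' Δ)) :
    (∃ k : ℕ, x = k • P.root α) ∨ ∃ δ : Δ, δ ≠ α ∧ 0 < hΔ.coord δ x := by
  induction hx using AddSubmonoid.closure_induction with
  | mem x h =>
    obtain ⟨δ', h, rfl⟩ := h
    by_cases hd : (⟨δ', h⟩ : Δ) = α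
    · subst hd; exact Or.inl ⟨1, by simp⟩
    · exact Or.inr ⟨⟨δ', h⟩, hd, by simp [hΔ.coord_self ⟨δ', h⟩]⟩
  | zero => exact Or.inl ⟨0, by simp⟩
  | add x y hx' hy' hx hy =>
    rcases hx with ⟨k, rfl⟩ | ⟨δ, hd, hδ⟩
    · rcases hy with ⟨l, rfl⟩ | ⟨δ, hd, hδ⟩
      · exact Or.inl ⟨k + l, (add_smul _ _ _).symm⟩
      · refine Or.inr ⟨δ, hd, ?_⟩
        rw [map_add]
        exact add_pos_of_nonneg_of_pos (hΔ.coord_nonneg_of_mem δ hx') hδ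
    · refine Or.inr ⟨δ, hd, ?_⟩
      rw [map_add]
      exact add_pos_of_pos_of_nonneg hδ (hΔ.coord_nonneg_of_mem δ hy')

omit hΔ in
lemma mem_posRoots_of_mem {δ : ι} (h : δ ∈ Δ) : δ ∈ posRoots P Δ :=
  AddSubmonoid.subset_closure ⟨δ, h, rfl⟩

lemma IsBasis.mem_or_neg (γ : ι) : γ ∈ posRoots P Δ ∨ neg P γ ∈ posRoots P Δ := by
  simpa [posRoots] using hΔ.mem_or_neg_mem γ

lemma IsBasis.neg_notMem {γ : ι} (h : γ ∈ posRoots P Δ) : neg P γ ∉ posRoots P Δ := by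
  intro h'
  rcases hΔ.eq_zero_or_coord_pos h with h0 | ⟨δ, hδ⟩
  · exact P.ne_zero γ h0
  · have := hΔ.coord_nonneg_of_mem δ h'
    rw [root_neg, map_neg] at this
    linarith

lemma IsBasis.neg_mem_iff {γ : ι} : neg P γ ∈ posRoots P Δ ↔ γ ∉ posRoots P Δ :=
  ⟨fun h h' => hΔ.neg_notMem h' h, fun h => (hΔ.mem_or_neg γ).resolve_left h⟩

lemma IsBasis.mem_of_coord_pos {γ : ι} (δ : Δ) (h : 0 < hΔ.coord δ (P.root γ)) :
    γ ∈ posRoots P Δ := by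
  by_contra hn
  have := hΔ.coord_nonneg_of_mem δ (hΔ.neg_mem_iff.2 hn)
  rw [root_neg, map_neg] at this
  linarith

lemma IsBasis.ray_subset (α : Δ) : ray P α ⊆ posRoots P Δ := by
  rintro γ (rfl | hγ)
  · exact mem_posRoots_of_mem α.2
  · exact hΔ.mem_of_coord_pos α (by rw [hγ, map_nsmul]; simp)

lemma IsBasis.coord_of_mem_ray {α δ : Δ} {γ : ι} (hγ : γ ∈ ray P α) (h : δ ≠ α) :
    hΔ.coord δ (P.root γ) = 0 := by
  rcases hγ with rfl | hγ
  · exact hΔ.coord_of_ne h.symm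
  · rw [hγ, map_nsmul, hΔ.coord_of_ne h.symm, smul_zero]

end Coord

/-- Evaluating at the coroot of `γ` gives `2 = k z` with `z` an integer, so `k` divides `2`. -/
lemma mem_ray_of_eq_nsmul [P.IsCrystallographic] {α γ : ι} {k : ℕ}
    (h : P.root γ = k • P.root α) : γ ∈ ray P α := by
  obtain ⟨z, hz⟩ := P.exists_value (S := ℤ) α γ
  have h2 : (2 : ℝ) = k * P.pairing α γ := by
    rw [← P.pairing_same γ, ← P.root_coroot_eq_pairing, h, map_nsmul, LinearMap.smul_apply,
      P.root_coroot_eq_pairing, nsmul_eq_mul]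
  rw [← hz] at h2
  have h3 : (2 : ℤ) = k * z := by
    have : ((2 : ℤ) : ℝ) = ((k * z : ℤ) : ℝ) := by push_cast; simpa using h2
    exact_mod_cast this
  have h4 : k ∣ 2 := by exact_mod_cast Dvd.intro z h3.symm
  rcases (Nat.dvd_prime Nat.prime_two).1 h4 with rfl | rfl
  · exact Or.inl (P.root.injective (by simpa using h))
  · exact Or.inr h

/-! ### Simple reflections and positive systems. -/

section Simple

variable [P.IsCrystallographic] {Δ : Set ι} (hΔ : IsBasis P Δ)
include hΔ

lemma IsBasis.mem_ray_or_coord_pos (α : Δ) {γ : ι} (hγ : γ ∈ posRoots P Δ) :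
    γ ∈ ray P α ∨ ∃ δ : Δ, δ ≠ α ∧ 0 < hΔ.coord δ (P.root γ) := by
  rcases hΔ.multiple_or_coord_pos α hγ with ⟨k, hk⟩ | h
  · exact Or.inl (mem_ray_of_eq_nsmul hk)
  · exact Or.inr h

/-- This criterion is visibly stable under adding multiples of `α`, hence under `r_α` and under the
commutator relations with `U_α` and `U_{-α}`. -/
lemma IsBasis.mem_diff_ray_iff (α : Δ) {γ : ι} :
    γ ∈ posRoots P Δ \ ray P α ↔ ∃ δ : Δ, δ ≠ α ∧ 0 < hΔ.coord δ (P.root γ) := by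
  refine ⟨fun h => (hΔ.mem_ray_or_coord_pos α h.1).resolve_left h.2, fun ⟨δ, hd, h⟩ =>
    ⟨hΔ.mem_of_coord_pos δ h, fun hr => ?_⟩⟩
  rw [hΔ.coord_of_mem_ray hr hd] at h
  exact h.false

lemma IsBasis.reflectionPerm_mem (α : Δ) {γ : ι} (h : γ ∈ posRoots P Δ \ ray P α) :
    P.reflectionPerm α γ ∈ posRoots P Δ \ ray P α := by
  rw [hΔ.mem_diff_ray_iff] at h ⊢
  obtain ⟨δ, hd, h⟩ := h
  refine ⟨δ, hd, ?_⟩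
  rwa [P.root_reflectionPerm, P.reflection_apply_root, map_sub, map_smul, hΔ.coord_of_ne hd.symm,
    smul_zero, sub_zero]

/-- A simple reflection permutes the positive roots outside `{α, 2α}`, because it changes only the
`α`-coordinate, and it negates the roots of this ray. -/
lemma IsBasis.posRoots_reflection (α : Δ) : posRoots P (P.reflectionPerm α '' Δ) =
    (posRoots P Δ \ ray P α) ∪ {γ | neg P γ ∈ ray P α} := by
  have hw := isAut_reflectionPerm P (α : ι)
  ext γ
  obtain ⟨γ, rfl⟩ := (P.reflectionPerm α).surjective γ
  rw [hw.mem_posRoots_image, Set.mem_union, Set.mem_ofPred, ← hw.neg_apply]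
  by_cases hr : γ ∈ ray P α
  · simp only [hΔ.ray_subset α hr, true_iff]
    right
    rwa [hw.neg_apply, reflectionPerm_eq_neg_of_mem_ray hr, neg_neg_index]
  · constructor
    · exact fun h => Or.inl (hΔ.reflectionPerm_mem α ⟨h, hr⟩)
    · rintro (h | h)
      · have := hΔ.reflectionPerm_mem α h
        rw [P.reflectionPerm_self] at this
        exact this.1
      · have := hw.mem_ray h
        rw [P.reflectionPerm_self, show P.reflectionPerm α α = neg P α from rfl] at this
        have h2 := neg_mem_ray this
        rw [neg_neg_index, neg_neg_index] at h2
        exact absurd h2 hr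

/-- If the positive roots of `Δ` are not all positive for `Δ'`, a simple reflection decreases the
number of positive roots of `Δ` that are negative for `Δ'`. -/
lemma IsBasis.ncard_reflection_lt [Finite ι] {Δ' : Set ι} (hΔ' : IsBasis P Δ') (α : Δ)
    (hα : (α : ι) ∉ posRoots P Δ') :
    (posRoots P (P.reflectionPerm α '' Δ) \ posRoots P Δ').ncard <
      (posRoots P Δ \ posRoots P Δ').ncard := by
  apply Set.ncard_lt_ncard _ (Set.toFinite _)
  rw [hΔ.posRoots_reflection, Set.ssubset_iff_of_subset]
  · refine ⟨α, ⟨mem_posRoots_of_mem α.2, hα⟩, fun h => ?_⟩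
    rcases h.1 with h | h
    · exact h.2 (self_mem_ray P _)
    · exact hΔ.neg_notMem (mem_posRoots_of_mem α.2) (hΔ.ray_subset α h)
  · rintro γ ⟨h | h, h'⟩
    · exact ⟨h.1, h'⟩
    · exfalso
      have h2 := hΔ'.neg_mem_iff.2 h'
      rcases h with h | h
      · rw [h] at h2; exact hα h2
      · rcases hΔ'.eq_zero_or_coord_pos h2 with h0 | ⟨δ, hδ⟩
        · exact P.ne_zero _ h0
        · rw [h, map_nsmul] at hδ
          exact hα (hΔ'.mem_of_coord_pos δ (by simpa using hδ))

-- Each positive system contains exactly one of `γ` and `-γ`, so an inclusion between two of them is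
-- an equality.
omit [P.IsCrystallographic] in
lemma IsBasis.posRoots_eq_of_subset {Δ' : Set ι} (hΔ' : IsBasis P Δ')
    (h : Δ ⊆ posRoots P Δ') : posRoots P Δ = posRoots P Δ' := by
  have hs : posRoots P Δ ⊆ posRoots P Δ' := by
    intro γ hγ
    refine (AddSubmonoid.closure_le.2 ?_ :
      AddSubmonoid.closure (P.root '' Δ) ≤ AddSubmonoid.closure (P.root '' Δ')) hγ
    rintro _ ⟨δ, hδ, rfl⟩
    exact h hδ
  refine hs.antisymm fun γ hγ => ?_
  by_contra hn
  exact hΔ'.neg_notMem hγ (hs (hΔ.neg_mem_iff.2 hn))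

/-- Positive systems are connected by simple reflections. -/
theorem IsBasis.gallery [Finite ι] (Q : Set ι → Prop)
    (hQ : ∀ Δ, IsBasis P Δ → ∀ α ∈ Δ, Q (posRoots P Δ) →
      Q (posRoots P (P.reflectionPerm α '' Δ)))
    {Δ' : Set ι} (hΔ' : IsBasis P Δ') (h : Q (posRoots P Δ)) : Q (posRoots P Δ') := by
  induction hn : (posRoots P Δ \ posRoots P Δ').ncard using Nat.strong_induction_on
    generalizing Δ with
  | _ n ih =>
    by_cases hs : Δ ⊆ posRoots P Δ'
    · rwa [← hΔ.posRoots_eq_of_subset hΔ' hs]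
    · obtain ⟨α, hα, hα'⟩ := Set.not_subset.1 hs
      have := hΔ.ncard_reflection_lt hΔ' ⟨α, hα⟩ hα'
      exact ih _ (hn ▸ this) ((isAut_reflectionPerm P α).isBasis_image hΔ) (hQ Δ hΔ α hα h) rfl

/-- A property of roots that holds on the rays of the simple roots and descends along simple
reflections holds for every positive root. -/
theorem IsBasis.forall_posRoots [Finite ι] (Q : Set ι → ι → Prop)
    (hQ : ∀ Δ, IsBasis P Δ → ∀ α ∈ Δ, ∀ γ ∈ ray P α, Q Δ γ)
    (hQ' : ∀ Δ, IsBasis P Δ → ∀ α ∈ Δ, ∀ γ, Q (P.reflectionPerm α '' Δ) γ → Q Δ γ)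
    {γ : ι} (hγ : γ ∈ posRoots P Δ) : Q Δ γ := by
  -- Walk from `Δ` towards `-Δ`. The root `γ` is positive at the start and negative at the end, so
  -- it changes sign at some step, and there it lies on the ray of the simple root that is crossed.
  have hΔ' := (isAut_negPerm P).isBasis_image hΔ
  have hγ' : γ ∉ posRoots P (negPerm P '' Δ) := by
    rw [(isAut_negPerm P).posRoots_image]
    rintro ⟨γ', h, rfl⟩
    exact hΔ.neg_notMem h hγ
  generalize negPerm P '' Δ = Δ' at hΔ' hγ'
  induction hn : (posRoots P Δ \ posRoots P Δ').ncard using Nat.strong_induction_on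
    generalizing Δ with
  | _ n ih =>
    by_cases hs : Δ ⊆ posRoots P Δ'
    · rw [← hΔ.posRoots_eq_of_subset hΔ' hs] at hγ'
      exact absurd hγ hγ'
    · obtain ⟨α, hα, hα'⟩ := Set.not_subset.1 hs
      by_cases hr : γ ∈ ray P α
      · exact hQ Δ hΔ α hα γ hr
      · have := hΔ.ncard_reflection_lt hΔ' ⟨α, hα⟩ hα'
        refine hQ' Δ hΔ α hα γ
          (ih _ (hn ▸ this) ((isAut_reflectionPerm P α).isBasis_image hΔ) ?_ rfl)
        rw [hΔ.posRoots_reflection ⟨α, hα⟩]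
        exact Or.inl ⟨hγ, hr⟩

end Simple

end Bases

/-! ### Roots and chambers in `V_R` -/

section RootMaps

variable {ι : Type u₁} {M : Type u₂} {V : Type u₃}
  [AddCommGroup M] [Module ℝ M] [AddCommGroup V] [Module ℝ V] {P : RootPairing ι ℝ M V}
  [P.IsCrystallographic] {R : Type u₄} [AddCommGroup R]

@[simp] lemma rootMap_tmul (α : ι) (x : VZ P) (r : R) :
    rootMap P R α (x ⊗ₜ r) = P.root'In ℤ α x • r := by
  simp [rootMap]

lemma coe_root'In (α : ι) (x : VZ P) : ((P.root'In ℤ α x : ℤ) : ℝ) = P.root' α x :=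
  P.algebraMap_root'In_apply ℤ α x

/-- Roots take integer values on `V_ℤ`, so an integral relation between real functionals already
holds over `ℤ` and survives tensoring with `R`. -/
lemma rootMap_sum {κ : Type*} {s : Finset κ} {c : κ → ℤ} {i : κ → ι} {γ : ι}
    (h : P.root γ = ∑ k ∈ s, c k • P.root (i k)) (v : VR P R) :
    rootMap P R γ v = ∑ k ∈ s, c k • rootMap P R (i k) v := by
  induction v using TensorProduct.induction_on with
  | zero => simp
  | tmul x r =>
    have : P.root'In ℤ γ x = ∑ k ∈ s, c k * P.root'In ℤ (i k) x := by
      have h2 : ((P.root'In ℤ γ x : ℤ) : ℝ) = ((∑ k ∈ s, c k * P.root'In ℤ (i k) x : ℤ) : ℝ) := by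
        push_cast
        simp only [coe_root'In, RootPairing.root', h]
        simp
      exact_mod_cast h2
    simp [this, Finset.sum_smul, mul_smul]
  | add x y hx hy => simp [hx, hy, Finset.sum_add_distrib]

lemma rootMap_add_smul {α β γ : ι} {a b : ℤ} (h : P.root γ = a • P.root α + b • P.root β)
    (v : VR P R) : rootMap P R γ v = a • rootMap P R α v + b • rootMap P R β v := by
  have := rootMap_sum (P := P) (s := Finset.univ) (c := ![a, b]) (i := ![α, β]) (γ := γ)
    (by simpa [Fin.sum_univ_two] using h) v
  simpa [Fin.sum_univ_two] using this

@[simp] lemma rootMap_neg (α : ι) (v : VR P R) : rootMap P R (neg P α) v = -rootMap P R α v := by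
  have := rootMap_add_smul (P := P) (α := α) (β := α) (γ := neg P α) (a := -1) (b := 0) (by simp) v
  simpa using this

lemma rootMap_reflectionMap (α β : ι) (v : VR P R) :
    rootMap P R (P.reflectionPerm α β) (reflectionMap P R α v) = rootMap P R β v := by
  induction v using TensorProduct.induction_on with
  | zero => simp
  | tmul x r =>
    have h1 : reflectionMap P R α (x ⊗ₜ r) =
        (Module.preReflection (P.corootSpanMem ℤ α) (P.root'In ℤ α) x) ⊗ₜ r := by
      simp [reflectionMap]
    have h2 : P.root'In ℤ (P.reflectionPerm α β)
        (Module.preReflection (P.corootSpanMem ℤ α) (P.root'In ℤ α) x) = P.root'In ℤ β x := by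
      have : ((P.root'In ℤ (P.reflectionPerm α β)
        (Module.preReflection (P.corootSpanMem ℤ α) (P.root'In ℤ α) x) : ℤ) : ℝ) =
          ((P.root'In ℤ β x : ℤ) : ℝ) := by
        rw [Module.preReflection_apply, map_sub, map_smul, Int.cast_sub, smul_eq_mul,
          Int.cast_mul, coe_root'In, coe_root'In, coe_root'In, coe_root'In]
        simp only [RootPairing.root', P.root_reflectionPerm, P.reflection_apply_root, map_sub,
          map_smul, LinearMap.sub_apply, LinearMap.smul_apply, P.root_coroot_eq_pairing,
          P.pairing_same, smul_eq_mul]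
        ring
      exact_mod_cast this
    rw [h1, rootMap_tmul, rootMap_tmul, h2]
  | add x y hx hy => simp only [map_add, hx, hy]

omit [P.IsCrystallographic] in
lemma exists_coeff [Fintype ι] {Δ : Set ι} {x : M} (hx : x ∈ AddSubmonoid.closure (P.root '' Δ)) :
    ∃ c : ι → ℕ, (∀ i ∉ Δ, c i = 0) ∧ x = ∑ i, c i • P.root i := by
  classical
  induction hx using AddSubmonoid.closure_induction with
  | mem x h =>
    obtain ⟨δ, h, rfl⟩ := h
    refine ⟨Pi.single δ 1, fun i hi => ?_, ?_⟩
    · rw [Pi.single_apply, if_neg]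
      rintro rfl
      exact hi h
    · simp [Pi.single_apply, ite_smul]
  | zero => exact ⟨0, by simp⟩
  | add x y _ _ hx hy =>
    obtain ⟨c, hc, rfl⟩ := hx
    obtain ⟨d, hd, rfl⟩ := hy
    exact ⟨c + d, fun i hi => by simp [hc i hi, hd i hi],
      by simp [add_smul, Finset.sum_add_distrib]⟩

lemma exists_rootMap_eq [Fintype ι] {Δ : Set ι} {γ : ι} (hγ : γ ∈ posRoots P Δ) :
    ∃ c : ι → ℕ, (∀ i ∉ Δ, c i = 0) ∧ (∃ i, c i ≠ 0) ∧
      ∀ v : VR P R, rootMap P R γ v = ∑ i, c i • rootMap P R i v := by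
  obtain ⟨c, hc, h⟩ := exists_coeff hγ
  refine ⟨c, hc, ?_, fun v => ?_⟩
  · by_contra! h0
    exact P.ne_zero γ (by simp [h, h0])
  · have := rootMap_sum (P := P) (R := R) (s := Finset.univ) (c := fun i => (c i : ℤ)) (i := id)
      (γ := γ) (by simpa using h) v
    simpa using this

lemma rootMap_eq_zero_of_basis [Finite ι] {Δ : Set ι} (hΔ : IsBasis P Δ) {v : VR P R}
    (h : ∀ δ ∈ Δ, rootMap P R δ v = 0) (γ : ι) : rootMap P R γ v = 0 := by
  have := Fintype.ofFinite ι
  have key : ∀ γ ∈ posRoots P Δ, rootMap P R γ v = 0 := by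
    intro γ hγ
    obtain ⟨c, hc, -, h2⟩ := exists_rootMap_eq (R := R) hγ
    rw [h2]
    refine Finset.sum_eq_zero fun i _ => ?_
    by_cases hi : i ∈ Δ
    · rw [h i hi, smul_zero]
    · rw [hc i hi, zero_smul]
  rcases hΔ.mem_or_neg γ with h | h
  · exact key γ h
  · simpa using key _ h

/-- The roots span `M`, so together they embed `V_ℤ` in `ℤ^ι`. As `R` is torsion-free, it is flat
over `ℤ`, and the embedding persists after tensoring. -/
lemma eq_zero_of_rootMap_eq_zero [Finite ι] [P.IsRootSystem] [Module.IsTorsionFree ℤ R]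
    {v : VR P R} (h : ∀ γ, rootMap P R γ v = 0) : v = 0 := by
  have := Fintype.ofFinite ι
  classical
  let f : VZ P →ₗ[ℤ] (ι → ℤ) := LinearMap.pi fun γ => P.root'In ℤ γ
  have hf : Function.Injective f := by
    rw [← LinearMap.ker_eq_bot, LinearMap.ker_eq_bot']
    intro x hx
    have hx' (γ : ι) : P.toLinearMap (P.root γ) (x : V) = 0 := by
      have h1 := congrFun hx γ
      have h2 := coe_root'In (P := P) γ x
      rw [show P.root'In ℤ γ x = 0 from h1] at h2
      simpa using h2.symm
    have h3 : P.toLinearMap.flip (x : V) = 0 := by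
      have : Submodule.span ℝ (Set.range P.root) ≤ LinearMap.ker (P.toLinearMap.flip (x : V)) := by
        rw [Submodule.span_le]
        rintro _ ⟨γ, rfl⟩
        exact hx' γ
      rw [show Submodule.span ℝ (Set.range P.root) = ⊤ from RootPairing.IsRootSystem.span_root_eq_top] at this
      ext m
      exact this (Submodule.mem_top (x := m))
    apply Subtype.ext
    exact P.flip.toPerfPair.injective (by simpa using h3)
  have h2 := Module.Flat.rTensor_preserves_injective_linearMap (M := R) f hf
  apply h2
  rw [map_zero]
  apply ((TensorProduct.comm ℤ (ι → ℤ) R).trans (TensorProduct.piScalarRight ℤ ℤ R ι)).injective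
  rw [map_zero]
  ext γ
  rw [Pi.zero_apply, ← h γ]
  generalize v = w
  induction w using TensorProduct.induction_on with
  | zero => simp
  | tmul x r => simp [f]
  | add x y hx hy => simp only [map_add, Pi.add_apply, hx, hy]

end RootMaps

/-! ### Vector chambers and their germs. -/

section Chambers

variable {ι : Type u₁} {M : Type u₂} {V : Type u₃}
  [AddCommGroup M] [Module ℝ M] [AddCommGroup V] [Module ℝ V] {P : RootPairing ι ℝ M V}
  [P.IsCrystallographic] {R : Type u₄} [AddCommGroup R] [LinearOrder R] [IsOrderedAddMonoid R]

lemma rootMap_pos_of_mem_posRoots [Finite ι] {Δ : Set ι} {γ : ι} (hγ : γ ∈ posRoots P Δ)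
    {v : VR P R} (hv : v ∈ chamber P R Δ) : 0 < rootMap P R γ v := by
  have := Fintype.ofFinite ι
  obtain ⟨c, hc, ⟨i, hi⟩, h⟩ := exists_rootMap_eq (R := R) hγ
  rw [h]
  refine Finset.sum_pos' (fun j _ => ?_) ⟨i, Finset.mem_univ _, ?_⟩
  · by_cases hj : j ∈ Δ
    · exact nsmul_nonneg (hv j hj).le _
    · rw [hc j hj, zero_smul]
  · have hiΔ : i ∈ Δ := by
      by_contra hn
      exact hi (hc i hn)
    exact nsmul_pos (hv i hiΔ) hi

/-- Nonemptiness is essential: every root is positive on the empty set. -/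
lemma IsBasis.rootsPosOn_chamber [Finite ι] {Δ : Set ι} (hΔ : IsBasis P Δ)
    (hne : (chamber P R Δ).Nonempty) : rootsPosOn P R (chamber P R Δ) = posRoots P Δ := by
  ext γ
  refine ⟨fun h => ?_, fun h v hv => rootMap_pos_of_mem_posRoots h hv⟩
  obtain ⟨v, hv⟩ := hne
  by_contra hn
  have h1 := rootMap_pos_of_mem_posRoots (hΔ.neg_mem_iff.2 hn) hv
  rw [rootMap_neg] at h1
  have h2 := h v hv
  exact lt_asymm h2 (neg_pos.1 h1)

/-- The value of `α` on the sum of the positive coroots. The reflection `r_α` permutes the positive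
roots outside the ray and negates their contributions, which cancel; the contributions of `α` and of
`2α` (if it is a root) are `2` and `1`. -/
lemma IsBasis.sum_pairing_pos [Fintype ι] {Δ : Set ι} (hΔ : IsBasis P Δ)
    [DecidablePred (· ∈ posRoots P Δ)] (α : Δ) :
    0 < ∑ β with β ∈ posRoots P Δ, P.pairing α β := by
  classical
  rw [← Finset.sum_filter_add_sum_filter_not _ (· ∈ ray P (α : ι)), Finset.filter_filter,
    Finset.filter_filter]
  have h2 : ∑ β with β ∈ posRoots P Δ ∧ β ∉ ray P (α : ι), P.pairing α β = 0 := by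
    have : ∑ β with β ∈ posRoots P Δ ∧ β ∉ ray P (α : ι), P.pairing α β =
        ∑ β with β ∈ posRoots P Δ ∧ β ∉ ray P (α : ι), -P.pairing α β := by
      refine Finset.sum_nbij' (P.reflectionPerm α) (P.reflectionPerm α) ?_ ?_ ?_ ?_ ?_
      · intro β hβ
        simp only [Finset.mem_filter, Finset.mem_univ, true_and] at hβ ⊢
        exact hΔ.reflectionPerm_mem α hβ
      · intro β hβ
        simp only [Finset.mem_filter, Finset.mem_univ, true_and] at hβ ⊢
        exact hΔ.reflectionPerm_mem α hβ
      · exact fun β _ => P.reflectionPerm_self _ _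
      · exact fun β _ => P.reflectionPerm_self _ _
      · intro β _
        rw [P.pairing_reflectionPerm, P.pairing_reflectionPerm_self_left, _root_.neg_neg]
    rw [Finset.sum_neg_distrib] at this
    linarith
  rw [h2, add_zero]
  have hp : ∀ β ∈ ray P (α : ι), 0 < P.pairing α β := by
    rintro β (rfl | hβ)
    · rw [P.pairing_same]; norm_num
    · have : (2 : ℝ) = 2 * P.pairing α β := by
        conv_lhs => rw [← P.pairing_same β, ← P.root_coroot_eq_pairing, hβ, map_nsmul,
          LinearMap.smul_apply, P.root_coroot_eq_pairing, nsmul_eq_mul]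
        norm_num
      linarith
  refine Finset.sum_pos (fun β hβ => hp β (Finset.mem_filter.1 hβ).2.2) ⟨α, ?_⟩
  simp only [Finset.mem_filter, Finset.mem_univ, true_and]
  exact ⟨mem_posRoots_of_mem α.2, self_mem_ray P _⟩

lemma IsBasis.exists_tmul_mem_chamber [Finite ι] {Δ : Set ι} (hΔ : IsBasis P Δ) :
    ∃ ρ : VZ P, ∀ r : R, 0 < r → ρ ⊗ₜ r ∈ chamber P R Δ := by
  classical
  have := Fintype.ofFinite ι
  refine ⟨∑ β with β ∈ posRoots P Δ, P.corootSpanMem ℤ β, fun r hr δ hδ => ?_⟩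
  rw [rootMap_tmul]
  have h : 0 < P.root'In ℤ δ (∑ β with β ∈ posRoots P Δ, P.corootSpanMem ℤ β) := by
    have h1 := hΔ.sum_pairing_pos ⟨δ, hδ⟩
    have h2 : ((P.root'In ℤ δ (∑ β with β ∈ posRoots P Δ, P.corootSpanMem ℤ β) : ℤ) : ℝ) =
        ∑ β with β ∈ posRoots P Δ, P.pairing δ β := by
      rw [coe_root'In]
      simp
    rw [← h2] at h1
    exact_mod_cast h1
  exact zsmul_pos hr h

variable {A : Type u₅} [AddTorsor (VR P R) A]

omit [LinearOrder R] [IsOrderedAddMonoid R] in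
lemma rootAt_vadd (o : A) (α : ι) (v : VR P R) (x : A) :
    rootAt P R o α (v +ᵥ x) = rootMap P R α v + rootAt P R o α x := by
  rw [rootAt, rootAt, vadd_vsub_assoc, map_add]

omit [LinearOrder R] [IsOrderedAddMonoid R] in
lemma rootAt_sub (o : A) (α : ι) (x y : A) :
    rootAt P R o α x - rootAt P R o α y = rootMap P R α (x -ᵥ y) := by
  rw [rootAt, rootAt, ← map_sub, vsub_sub_vsub_cancel_right]

/-- Density makes the right neighbourhoods of `0` in `R` nontrivial. The scalar action is not
assumed to be monotone, so half of `b - a` is proved positive by doubling it. -/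
lemma densely_ordered_of_module_rat (R : Type*) [AddCommGroup R] [LinearOrder R]
    [IsOrderedAddMonoid R] [Module ℚ R] : DenselyOrdered R := by
  refine ⟨fun a b hab => ?_⟩
  set c : R := (1 / 2 : ℚ) • (b - a)
  have hc : c + c = b - a := by
    rw [← add_smul]
    norm_num
  have h0 : 0 < c := by
    by_contra! h
    have : b - a ≤ 0 := hc ▸ add_nonpos h h
    exact absurd hab (sub_nonpos.1 this).not_gt
  refine ⟨a + c, lt_add_of_pos_right a h0, ?_⟩
  have : b = a + c + c := by rw [add_assoc, hc]; abel
  rw [this]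
  exact lt_add_of_pos_right _ h0

open Filter Topology in
/-- The members of the germ of a chamber contain two points whose difference is regular. -/
lemma exists_mem_germ [Finite ι] [Module ℚ R] (hR : IsEmpty ι ∨ Nontrivial R) {Δ : Set ι}
    (hΔ : IsBasis P Δ) (o x : A) {Ω : Set A} (hΩ : Ω ∈ germ P R o x (chamber P R Δ)) :
    ∃ y ∈ Ω, ∃ z ∈ Ω, z -ᵥ y ∈ chamber P R Δ := by
  rcases hR with hι | hR
  · have h0 (v : VR P R) : v ∈ chamber P R Δ := fun α => isEmptyElim α
    have hx : x ∈ Ω := by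
      let := apartmentTopology P R o
      obtain ⟨s, hs, t, ht, rfl⟩ := Filter.mem_inf_iff.1 hΩ
      exact ⟨mem_of_mem_nhds hs, (Filter.mem_principal.1 ht) ⟨0, h0 _, zero_vadd _ _⟩⟩
    exact ⟨x, hx, x, hx, h0 _⟩
  · let : TopologicalSpace R := Preorder.topology R
    have : OrderTopology R := ⟨rfl⟩
    have := densely_ordered_of_module_rat R
    obtain ⟨ρ, hρ⟩ := hΔ.exists_tmul_mem_chamber (R := R)
    -- The points sought are `x + ρ ⊗ r` and `x + ρ ⊗ 2r` with `r > 0` small: both tend to the germ,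
    -- and they differ by `ρ ⊗ r`.
    have key (n : ℕ) (hn : n ≠ 0) :
        Tendsto (fun r : R => (ρ ⊗ₜ (n • r) : VR P R) +ᵥ x) (𝓝[>] 0)
          (germ P R o x (chamber P R Δ)) := by
      refine tendsto_inf.2 ⟨?_, tendsto_principal.2 ?_⟩
      · rw [apartmentTopology, TopologicalSpace.tendsto_nhds_generateFrom_iff]
        rintro _ ⟨α, s, rfl⟩ hx
        refine mem_nhdsWithin_of_mem_nhds ?_
        have hc : Continuous fun r : R =>
            rootAt P R o α ((ρ ⊗ₜ (n • r) : VR P R) +ᵥ x) + s := by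
          simp only [rootAt_vadd, rootMap_tmul]
          fun_prop
        refine (isOpen_Ioi.preimage hc).mem_nhds (x := 0) ?_
        simpa using hx
      · filter_upwards [self_mem_nhdsWithin] with r hr
        exact ⟨_, hρ _ (nsmul_pos hr hn), rfl⟩
    have hev : ∀ᶠ r in 𝓝[>] (0 : R), 0 < r := self_mem_nhdsWithin
    obtain ⟨r, hr, h1, h2⟩ := (hev.and
      (((key 1 one_ne_zero).eventually hΩ).and ((key 2 two_ne_zero).eventually hΩ))).exists
    refine ⟨_, h1, _, h2, ?_⟩
    rw [vadd_vsub_vadd_cancel_right, ← TensorProduct.tmul_sub, show 2 • r - 1 • r = r by rw [two_smul, one_smul, add_sub_cancel_right]]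
    exact hρ r hr

lemma IsBasis.chamber_nonempty [Finite ι] [Module ℚ R] (hR : IsEmpty ι ∨ Nontrivial R)
    {Δ : Set ι} (hΔ : IsBasis P Δ) : (chamber P R Δ).Nonempty := by
  obtain ⟨y, -, z, -, h⟩ := exists_mem_germ hR hΔ (A := VR P R) 0 0 Filter.univ_mem
  exact ⟨_, h⟩

end Chambers

/-! ### Consequences of the axioms of a root group datum -/

section Data

variable {ι : Type u₁} {M : Type u₂} {V : Type u₃}
  [AddCommGroup M] [Module ℝ M] [AddCommGroup V] [Module ℝ V] {P : RootPairing ι ℝ M V}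

lemma reflectionPerm_neg_self (α : ι) : P.reflectionPerm α (neg P α) = α := by
  rw [neg, P.reflectionPerm_self]

lemma reflectionPerm_conj (α γ β : ι) : P.reflectionPerm (P.reflectionPerm α γ)
    (P.reflectionPerm α β) = P.reflectionPerm α (P.reflectionPerm γ β) := by
  apply P.root.injective
  simp only [P.root_reflectionPerm, P.reflection_reflectionPerm]
  simp

lemma reflectionPerm_conj_mul (α γ : ι) : P.reflectionPerm (P.reflectionPerm α γ) *
    P.reflectionPerm α = P.reflectionPerm α * P.reflectionPerm γ := by
  ext β
  exact reflectionPerm_conj α γ β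

lemma reflectionPerm_eq_of_root_eq_smul [Finite ι] {α γ : ι} {t : ℝ}
    (h : P.root γ = t • P.root α) : P.reflectionPerm γ = P.reflectionPerm α := by
  have : IsAddTorsionFree V := .of_isTorsionFree ℝ V
  have h2 := P.smul_coroot_eq_of_root_eq_smul α γ t h
  ext β
  apply P.root.injective
  rw [P.root_reflectionPerm, P.root_reflectionPerm, P.reflection_apply, P.reflection_apply,
    h, RootPairing.coroot', RootPairing.coroot', ← h2, map_smul, LinearMap.smul_apply, smul_smul,
    smul_eq_mul, mul_comm]

lemma reflectionPerm_eq_of_mem_ray [Finite ι] {α γ : ι} (h : γ ∈ ray P α) :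
    P.reflectionPerm γ = P.reflectionPerm α := by
  rcases h with rfl | h
  · rfl
  · exact reflectionPerm_eq_of_root_eq_smul (t := 2)
      (by rw [h, ← Nat.cast_smul_eq_nsmul ℝ]; norm_num)

lemma reflectionPerm_neg [Finite ι] (α : ι) :
    P.reflectionPerm (neg P α) = P.reflectionPerm α :=
  reflectionPerm_eq_of_root_eq_smul (t := -1) (by simp)

namespace RootGroupDatum

variable {G : Type u₆} [Group G] (D : RootGroupDatum P G)

/-- Conjugation by `n` permutes the root groups according to `w`. -/
def Acts (n : G) (w : Equiv.Perm ι) : Prop := ∀ β u, n * u * n⁻¹ ∈ D.U (w β) ↔ u ∈ D.U β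

variable {D}

lemma Acts.mul {n n' : G} {w w' : Equiv.Perm ι} (h : D.Acts n w) (h' : D.Acts n' w') :
    D.Acts (n * n') (w * w') := by
  intro β u
  rw [Equiv.Perm.mul_apply, ← h' β, ← h (w' β)]
  simp only [mul_inv_rev, mul_assoc]

lemma Acts.inv {n : G} {w : Equiv.Perm ι} (h : D.Acts n w) : D.Acts n⁻¹ w⁻¹ := by
  intro β u
  rw [← h]
  simp [mul_assoc]

lemma acts_of_mem_M {α : ι} {m : G} (hm : m ∈ D.M α) : D.Acts m (P.reflectionPerm α) := by
  intro β u
  rw [← D.conj_U α β m hm, Subgroup.mem_map]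
  refine ⟨fun ⟨v, hv, h⟩ => ?_, fun h => ⟨u, h, by simp⟩⟩
  have : v = u := by simpa using h
  exact this ▸ hv

lemma mem_M_iff {α : ι} {m x : G} (hm : m ∈ D.M α) : x ∈ D.M α ↔ x * m⁻¹ ∈ D.T := by
  obtain ⟨m₀, h⟩ := D.M_coset α
  rw [h] at hm ⊢
  simp only [Set.mul_singleton, Set.mem_image, SetLike.mem_coe] at hm ⊢
  obtain ⟨t, ht, rfl⟩ := hm
  constructor
  · rintro ⟨s, hs, rfl⟩
    simpa [mul_assoc] using D.T.mul_mem hs (D.T.inv_mem ht)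
  · intro hx
    exact ⟨x * (t * m₀)⁻¹ * t, D.T.mul_mem hx ht, by group⟩

lemma T_mul_mem_M {α : ι} {m t : G} (hm : m ∈ D.M α) (ht : t ∈ D.T) : t * m ∈ D.M α := by
  rw [mem_M_iff hm]
  simpa

variable (D) in
lemma exists_mem_M (α : ι) : ∃ m, m ∈ D.M α := by
  obtain ⟨m, h⟩ := D.M_coset α
  exact ⟨m, h ▸ ⟨1, D.T.one_mem, m, rfl, one_mul m⟩⟩

/-- No axiom mentions conjugation by `T`. Given `β`, write `t = (t m) m⁻¹` with `m` and `t m` in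
`M_β`; the two reflections cancel. -/
lemma acts_of_mem_T {t : G} (ht : t ∈ D.T) : D.Acts t 1 := by
  intro β u
  obtain ⟨m, hm⟩ := D.exists_mem_M β
  have := (acts_of_mem_M (T_mul_mem_M hm ht)).mul (acts_of_mem_M hm).inv
  have h2 := this β u
  simpa using h2

lemma Acts.mem {n : G} {w : Equiv.Perm ι} (h : D.Acts n w) {β : ι} {u : G} (hu : u ∈ D.U β) :
    n * u * n⁻¹ ∈ D.U (w β) := (h β u).2 hu

lemma conj_T_mem {t u : G} {β : ι} (ht : t ∈ D.T) (hu : u ∈ D.U β) : t * u * t⁻¹ ∈ D.U β :=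
  (acts_of_mem_T ht).mem hu

lemma conj_M_mem {α β : ι} {m u : G} (hm : m ∈ D.M α) (hu : u ∈ D.U β) :
    m * u * m⁻¹ ∈ D.U (P.reflectionPerm α β) := (acts_of_mem_M hm).mem hu

variable (D) in
lemma exists_ne_one (α : ι) : ∃ u ∈ D.U α, u ≠ 1 :=
  (D.U α).ne_bot_iff_exists_ne_one.1 (D.U_ne_bot α) |>.elim fun u hu =>
    ⟨u, u.2, fun h => hu (Subtype.ext h)⟩

lemma exists_eq_mul {α : ι} {u : G} (hu : u ∈ D.U (neg P α)) (h1 : u ≠ 1) :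
    ∃ a ∈ D.U α, ∃ m ∈ D.M α, ∃ b ∈ D.U α, u = a * m * b := by
  obtain ⟨_, ⟨a, ha, m, hm, rfl⟩, b, hb, rfl⟩ := D.U_neg_subset α ⟨hu, h1⟩
  exact ⟨a, ha, m, hm, b, hb, rfl⟩

lemma exists_eq_mul' {α : ι} {u : G} (hu : u ∈ D.U α) (h1 : u ≠ 1) :
    ∃ a ∈ D.U (neg P α), ∃ m ∈ D.M (neg P α), ∃ b ∈ D.U (neg P α), u = a * m * b :=
  exists_eq_mul (by rwa [neg_neg_index]) h1

/-! #### The subgroups `M_α` -/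

section Basis

variable {Δ : Set ι} (hΔ : IsBasis P Δ)
include hΔ

lemma inter_neg {γ : ι} {u : G} (h : u ∈ D.U γ) (h' : u ∈ D.U (neg P γ)) : u = 1 := by
  rcases hΔ.mem_or_neg γ with hγ | hγ
  · have : u ∈ ({1} : Set G) := by
      rw [← D.inter_eq Δ hΔ]
      refine ⟨⟨1, D.T.one_mem, u, ?_, one_mul u⟩, ?_⟩
      · exact Subgroup.mem_iSup_of_mem γ (Subgroup.mem_iSup_of_mem hγ h)
      · exact Subgroup.mem_iSup_of_mem γ (Subgroup.mem_iSup_of_mem hγ h')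
    exact this
  · have : u ∈ ({1} : Set G) := by
      rw [← D.inter_eq Δ hΔ]
      refine ⟨⟨1, D.T.one_mem, u, ?_, one_mul u⟩, ?_⟩
      · exact Subgroup.mem_iSup_of_mem _ (Subgroup.mem_iSup_of_mem hγ h')
      · refine Subgroup.mem_iSup_of_mem _ (Subgroup.mem_iSup_of_mem hγ ?_)
        rwa [neg_neg_index]
    exact this

/-- Otherwise `x = a m b` with `a, b ∈ U_{-γ}`, and `m` would send `U_{-γ}` into itself as well as
into `U_γ`; these groups meet trivially. -/
lemma eq_one_of_normalizes_neg {γ : ι} {x : G} (hx : x ∈ D.U γ)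
    (h : ∀ u ∈ D.U (neg P γ), x * u * x⁻¹ ∈ D.U (neg P γ)) : x = 1 := by
  by_contra h1
  obtain ⟨a, ha, m, hm, b, hb, rfl⟩ := exists_eq_mul' hx h1
  obtain ⟨u, hu, hu1⟩ := D.exists_ne_one (neg P γ)
  have h2 := h (b⁻¹ * u * b) (mul_mem (mul_mem (inv_mem hb) hu) hb)
  have h3 : m * u * m⁻¹ ∈ D.U (neg P γ) := by
    have := mul_mem (mul_mem (inv_mem ha) h2) ha
    convert this using 1
    group
  have h4 := conj_M_mem hm hu
  rw [show P.reflectionPerm (neg P γ) (neg P γ) = γ from neg_neg_index P γ] at h4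
  have h5 := inter_neg hΔ h4 h3
  exact hu1 (conj_eq_one_iff.1 h5)

/-- On `U_{-γ}`, conjugation by `a` differs from conjugation by `a t c` by factors that normalize
`U_{-γ}`, so `a` normalizes `U_{-γ}`. The inverse gives the same for `c` and `U_γ`. -/
lemma eq_one_of_acts {γ : ι} {a t c : G} {w : Equiv.Perm ι} (ha : a ∈ D.U γ) (ht : t ∈ D.T)
    (hc : c ∈ D.U (neg P γ)) (h : D.Acts (a * t * c) w) (hw : w γ = γ)
    (hw' : w (neg P γ) = neg P γ) : a = 1 ∧ c = 1 := by
  have hi := h.inv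
  constructor
  · refine eq_one_of_normalizes_neg hΔ ha fun u hu => ?_
    have h1 := conj_T_mem (inv_mem ht) hu
    have h2 := h.mem (mul_mem (mul_mem (inv_mem hc) h1) hc)
    rw [hw'] at h2
    convert h2 using 1
    group
  · rw [← inv_eq_one]
    refine eq_one_of_normalizes_neg (γ := neg P γ) hΔ (inv_mem hc) fun u hu => ?_
    rw [neg_neg_index] at hu ⊢
    have h1 := conj_T_mem ht hu
    have h2 := hi.mem (mul_mem (mul_mem ha h1) (inv_mem ha))
    rw [Equiv.Perm.inv_eq_iff_eq.2 hw.symm] at h2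
    convert h2 using 1
    group

/-- A double coset of `U_γ` contains at most one element that exchanges `U_γ` and `U_{-γ}`. -/
lemma eq_of_swap {γ : ι} {m m' a b : G} {w w' : Equiv.Perm ι} (ha : a ∈ D.U γ) (hb : b ∈ D.U γ)
    (h : D.Acts m w) (h' : D.Acts m' w') (hw : w (neg P γ) = γ) (hw₂ : w γ = neg P γ)
    (hw' : w' (neg P γ) = γ) (hw₂' : w' γ = neg P γ) (he : m = a * m' * b) : m = m' := by
  have h1 : m * m'⁻¹ = a * 1 * (m' * b * m'⁻¹) := by rw [he]; group
  have h2 := h.mul h'.inv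
  rw [h1] at h2
  have h3 := h'.mem hb
  rw [hw₂'] at h3
  obtain ⟨rfl, h4⟩ := eq_one_of_acts hΔ ha D.T.one_mem h3 h2
    (by rw [Equiv.Perm.mul_apply, Equiv.Perm.inv_eq_iff_eq.2 hw'.symm, hw])
    (by rw [Equiv.Perm.mul_apply, Equiv.Perm.inv_eq_iff_eq.2 hw₂'.symm, hw₂])
  rw [conj_eq_one_iff.1 h4] at he
  simpa using he

/-- Take for `m` the middle factor of some `u ∈ U_{-α}`. Then `u⁻¹` and `t u t⁻¹` have middle
factors in `M_α`, which `eq_of_swap` identifies with `m⁻¹` and `t m t⁻¹`. The coset structure then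
extends this from one `m` to all of `M_α`. -/
lemma M_inv_and_conj {α : ι} : ∃ m ∈ D.M α, m⁻¹ ∈ D.M α ∧ ∀ t ∈ D.T, t * m * t⁻¹ ∈ D.M α := by
  obtain ⟨u, hu, h1⟩ := D.exists_ne_one (neg P α)
  obtain ⟨a, ha, m, hm, b, hb, rfl⟩ := exists_eq_mul hu h1
  have hA := acts_of_mem_M hm
  have hs : P.reflectionPerm α (neg P α) = α := reflectionPerm_neg_self α
  refine ⟨m, hm, ?_, fun t ht => ?_⟩
  · obtain ⟨c, hc, m', hm', d, hd, he⟩ := exists_eq_mul (inv_mem hu) (inv_ne_one.2 h1)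
    have : m⁻¹ = m' := by
      refine eq_of_swap hΔ (a := b * c) (b := d * a) (mul_mem hb hc) (mul_mem hd ha) hA.inv
        (acts_of_mem_M hm') ?_ ?_ hs rfl ?_
      · rw [P.reflectionPerm_inv, hs]
      · rw [P.reflectionPerm_inv]; rfl
      · rw [show b * c * m' * (d * a) = b * (c * m' * d) * a by group, ← he]
        group
    rwa [this]
  · obtain ⟨c, hc, m', hm', d, hd, he⟩ := exists_eq_mul (conj_T_mem ht hu)
      (mt conj_eq_one_iff.1 h1)
    have hT := acts_of_mem_T ht
    have : t * m * t⁻¹ = m' := by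
      refine eq_of_swap hΔ (a := (t * a * t⁻¹)⁻¹ * c) (b := d * (t * b * t⁻¹)⁻¹)
        (mul_mem (inv_mem (conj_T_mem ht ha)) hc) (mul_mem hd (inv_mem (conj_T_mem ht hb)))
        ((hT.mul hA).mul hT.inv) (acts_of_mem_M hm') ?_ ?_ hs rfl ?_
      · simpa using hs
      · simp [neg]
      · rw [show (t * a * t⁻¹)⁻¹ * c * m' * (d * (t * b * t⁻¹)⁻¹) =
          (t * a * t⁻¹)⁻¹ * (c * m' * d) * (t * b * t⁻¹)⁻¹ by group, ← he]
        group
    rwa [this]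

lemma conj_T_mem_T {α : ι} {m t : G} (hm : m ∈ D.M α) (ht : t ∈ D.T) : m * t * m⁻¹ ∈ D.T := by
  obtain ⟨m₁, hm₁, -, h⟩ := M_inv_and_conj (D := D) hΔ (α := α)
  have h1 := (mem_M_iff hm₁).1 (h t⁻¹ (inv_mem ht))
  have h2 := (mem_M_iff hm₁).1 hm
  have h3 := mul_mem (mul_mem h2 (mul_mem ht h1)) (inv_mem h2)
  convert h3 using 1
  group

lemma inv_mem_M {α : ι} {m : G} (hm : m ∈ D.M α) : m⁻¹ ∈ D.M α := by
  obtain ⟨m₁, hm₁, h, -⟩ := M_inv_and_conj (D := D) hΔ (α := α)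
  rw [mem_M_iff h]
  have h1 := conj_T_mem_T hΔ hm (inv_mem ((mem_M_iff hm).1 hm₁))
  have h2 := conj_T_mem_T hΔ h (inv_mem ((mem_M_iff hm₁).1 hm))
  convert h2 using 1
  group

lemma mul_mem_T {α : ι} {m m' : G} (hm : m ∈ D.M α) (hm' : m' ∈ D.M α) : m * m' ∈ D.T := by
  simpa using (mem_M_iff (inv_mem_M hΔ hm')).1 hm

lemma mul_T_mem_M {α : ι} {m t : G} (hm : m ∈ D.M α) (ht : t ∈ D.T) : m * t ∈ D.M α := by
  rw [mem_M_iff hm]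
  exact conj_T_mem_T hΔ hm ht

omit hΔ in
lemma M_eq_of_mem {α β : ι} {m : G} (hm : m ∈ D.M α) (hm' : m ∈ D.M β) : D.M α = D.M β := by
  ext x
  rw [mem_M_iff hm, mem_M_iff hm']

-- From `u = a m b` with `m ∈ M_{-α}` follows `a⁻¹ = (m b m⁻¹) m u⁻¹`, which lies in `U_α m U_α`.
-- The axiom also puts `a⁻¹` in `U_α M_α U_α`, and the middle factors agree by `eq_of_swap`.
variable (D) in
lemma M_neg (α : ι) : D.M (neg P α) = D.M α := by
  obtain ⟨u, hu, h1⟩ := D.exists_ne_one α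
  obtain ⟨a, ha, m, hm, b, hb, he⟩ := exists_eq_mul' hu h1
  have hA := acts_of_mem_M hm
  have hs : P.reflectionPerm (neg P α) (neg P α) = α := neg_neg_index P α
  have hs' : P.reflectionPerm (neg P α) α = neg P α := by
    simpa using reflectionPerm_neg_self (P := P) (neg P α)
  have hmb : m * b * m⁻¹ ∈ D.U α := hs ▸ hA.mem hb
  have ha1 : a ≠ 1 := by
    rintro rfl
    have hub : b * u⁻¹ = m⁻¹ := by rw [he]; group
    have h2 := hA.inv.mem hu
    rw [Equiv.Perm.inv_eq_iff_eq.2 hs.symm, ← hub] at h2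
    have h3 := mul_mem (mul_mem (inv_mem hb) h2) hb
    rw [show b⁻¹ * (b * u⁻¹ * u * (b * u⁻¹)⁻¹) * b = u by group] at h3
    exact h1 (inter_neg hΔ hu h3)
  obtain ⟨c, hc, m', hm', d, hd, he'⟩ := exists_eq_mul (inv_mem ha) (inv_ne_one.2 ha1)
  have : m = m' := by
    refine eq_of_swap hΔ (a := (m * b * m⁻¹)⁻¹ * c) (b := d * u) (mul_mem (inv_mem hmb) hc)
      (mul_mem hd hu) hA (acts_of_mem_M hm') hs hs' (reflectionPerm_neg_self α) rfl ?_
    rw [show (m * b * m⁻¹)⁻¹ * c * m' * (d * u) = (m * b * m⁻¹)⁻¹ * (c * m' * d) * u by group,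
      ← he', he]
    group
  exact M_eq_of_mem hm (this ▸ hm')

/-- An element of `U_{-2α}` decomposes both for `2α` and for `α`; both middle factors exchange `U_α`
and `U_{-α}`, hence are equal. -/
lemma M_of_mem_ray [Finite ι] {α γ : ι} (h : γ ∈ ray P α) : D.M γ = D.M α := by
  have hr := reflectionPerm_eq_of_mem_ray h
  rcases h with rfl | h
  · rfl
  have hle : D.U γ ≤ D.U α := (D.U_two_lt α γ h).le
  have hle' : D.U (neg P γ) ≤ D.U (neg P α) :=
    (D.U_two_lt _ _ (by rw [root_neg, root_neg, h, smul_neg])).le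
  obtain ⟨u, hu, h1⟩ := D.exists_ne_one (neg P γ)
  obtain ⟨a, ha, m, hm, b, hb, he⟩ := exists_eq_mul hu h1
  obtain ⟨a', ha', m', hm', b', hb', he'⟩ := exists_eq_mul (hle' hu) h1
  have : m = m' := by
    refine eq_of_swap (γ := α) hΔ (a := a⁻¹ * a') (b := b' * b⁻¹) (mul_mem (inv_mem (hle ha)) ha')
      (mul_mem hb' (inv_mem (hle hb))) (acts_of_mem_M hm) (acts_of_mem_M hm') ?_ ?_
      (reflectionPerm_neg_self α) rfl ?_
    · rw [hr, reflectionPerm_neg_self]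
    · rw [hr]; rfl
    · rw [show a⁻¹ * a' * m' * (b' * b⁻¹) = a⁻¹ * (a' * m' * b') * b⁻¹ by group, ← he', he]
      group
  exact M_eq_of_mem hm (this ▸ hm')

lemma conj_M_mem_M {n : G} {w : Equiv.Perm ι} (h : D.Acts n w) (hw : IsAut P w)
    (hT : ∀ t ∈ D.T, n * t * n⁻¹ ∈ D.T) {β : ι} {m : G} (hm : m ∈ D.M β) :
    n * m * n⁻¹ ∈ D.M (w β) := by
  obtain ⟨u, hu, h1⟩ := D.exists_ne_one (neg P β)
  obtain ⟨a, ha, m₁, hm₁, b, hb, rfl⟩ := exists_eq_mul hu h1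
  have hu' := h.mem hu
  rw [hw.neg_apply] at hu'
  obtain ⟨c, hc, m', hm', d, hd, he⟩ := exists_eq_mul hu' (mt conj_eq_one_iff.1 h1)
  have h2 : n * m₁ * n⁻¹ = m' := by
    refine eq_of_swap hΔ (γ := w β) (a := (n * a * n⁻¹)⁻¹ * c) (b := d * (n * b * n⁻¹)⁻¹)
      (mul_mem (inv_mem (h.mem ha)) hc) (mul_mem hd (inv_mem (h.mem hb)))
      ((h.mul (acts_of_mem_M hm₁)).mul h.inv) (acts_of_mem_M hm') ?_ ?_
      (reflectionPerm_neg_self _) rfl ?_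
    · rw [← hw.neg_apply]; simp [reflectionPerm_neg_self]
    · rw [← hw.neg_apply]; simp [neg]
    · rw [show (n * a * n⁻¹)⁻¹ * c * m' * (d * (n * b * n⁻¹)⁻¹) =
          (n * a * n⁻¹)⁻¹ * (c * m' * d) * (n * b * n⁻¹)⁻¹ by group, ← he]
      group
  rw [← h2] at hm'
  rw [mem_M_iff hm']
  have h3 := hT _ ((mem_M_iff hm₁).1 hm)
  convert h3 using 1
  group

end Basis

end RootGroupDatum

end Data

/-! ### The group `N` -/

section GroupN

variable {ι : Type u₁} {M : Type u₂} {V : Type u₃}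
  [AddCommGroup M] [Module ℝ M] [AddCommGroup V] [Module ℝ V] {P : RootPairing ι ℝ M V}

namespace RootGroupDatum

variable {G : Type u₆} [Group G] (D : RootGroupDatum P G)

/-- The subgroup generated by the pairs `(t, 1)` with `t ∈ T` and `(m, r_α)` with `m ∈ M_α`, `α` in
a set `S` of roots. -/
def lifts (S : Set ι) : Subgroup (G × Equiv.Perm ι) :=
  Subgroup.closure {p | (p.1 ∈ D.T ∧ p.2 = 1) ∨
    ∃ α ∈ S, p.1 ∈ D.M α ∧ p.2 = P.reflectionPerm α}

variable {D}

lemma mem_lifts_of_mem_T {S : Set ι} {t : G} (ht : t ∈ D.T) : (t, 1) ∈ D.lifts S :=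
  Subgroup.subset_closure (Or.inl ⟨ht, rfl⟩)

lemma mem_lifts_of_mem_M {S : Set ι} {α : ι} {m : G} (hα : α ∈ S) (hm : m ∈ D.M α) :
    (m, P.reflectionPerm α) ∈ D.lifts S :=
  Subgroup.subset_closure (Or.inr ⟨α, hα, hm, rfl⟩)

lemma acts_of_mem_lifts {S : Set ι} {p : G × Equiv.Perm ι} (hp : p ∈ D.lifts S) :
    D.Acts p.1 p.2 := by
  induction hp using Subgroup.closure_induction with
  | mem p hp =>
    rcases hp with ⟨h1, h2⟩ | ⟨α, -, h1, h2⟩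
    · exact h2 ▸ acts_of_mem_T h1
    · exact h2 ▸ acts_of_mem_M h1
  | one => exact acts_of_mem_T D.T.one_mem
  | mul p q _ _ hp hq => exact hp.mul hq
  | inv p _ hp => exact hp.inv

lemma isAut_of_mem_lifts {S : Set ι} {p : G × Equiv.Perm ι} (hp : p ∈ D.lifts S) :
    IsAut P p.2 := by
  induction hp using Subgroup.closure_induction with
  | mem p hp =>
    rcases hp with ⟨-, h2⟩ | ⟨α, -, -, h2⟩
    · exact h2 ▸ isAut_one P
    · exact h2 ▸ isAut_reflectionPerm P α
  | one => exact isAut_one P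
  | mul p q _ _ hp hq => exact hp.mul hq
  | inv p _ hp => exact hp.inv

lemma mem_N_of_mem_T {t : G} (ht : t ∈ D.T) : t ∈ D.N := Subgroup.subset_closure (Or.inl ht)

lemma mem_N_of_mem_lifts {S : Set ι} {p : G × Equiv.Perm ι} (hp : p ∈ D.lifts S) :
    p.1 ∈ D.N := by
  induction hp using Subgroup.closure_induction with
  | mem p hp =>
    rcases hp with ⟨h1, -⟩ | ⟨α, -, h1, -⟩
    · exact mem_N_of_mem_T h1
    · exact D.mem_N h1
  | one => exact one_mem _
  | mul p q _ _ hp hq => exact mul_mem hp hq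
  | inv p _ hp => exact inv_mem hp

/-- Some `w` suffices throughout, so the homomorphism from `N` to the Weyl group is never
constructed. -/
lemma exists_lift {n : G} (hn : n ∈ D.N) : ∃ w, (n, w) ∈ D.lifts Set.univ := by
  induction hn using Subgroup.closure_induction with
  | mem n h =>
    rcases h with h | h
    · exact ⟨1, mem_lifts_of_mem_T h⟩
    · obtain ⟨α, h⟩ := Set.mem_iUnion.1 h
      exact ⟨_, mem_lifts_of_mem_M (Set.mem_univ α) h⟩
  | one => exact ⟨1, one_mem _⟩
  | mul n n' _ _ hn hn' =>
    obtain ⟨w, hw⟩ := hn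
    obtain ⟨w', hw'⟩ := hn'
    exact ⟨w * w', mul_mem hw hw'⟩
  | inv n _ hn =>
    obtain ⟨w, hw⟩ := hn
    exact ⟨w⁻¹, inv_mem hw⟩

/-- Products of `k` elements of the `M_α`, for simple roots `α`, and of an element of `T`. -/
inductive Word (D : RootGroupDatum P G) (Δ : Set ι) : ℕ → G → Equiv.Perm ι → Prop
  | nil {t : G} (ht : t ∈ D.T) : Word D Δ 0 t 1
  | cons {k : ℕ} {n m : G} {w : Equiv.Perm ι} {α : ι} (h : Word D Δ k n w) (hα : α ∈ Δ)
      (hm : m ∈ D.M α) : Word D Δ (k + 1) (n * m) (w * P.reflectionPerm α)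

lemma Word.isAut {Δ : Set ι} {k : ℕ} {n : G} {w : Equiv.Perm ι} (h : D.Word Δ k n w) :
    IsAut P w := by
  induction h with
  | nil => exact isAut_one P
  | cons _ _ _ ih => exact ih.mul (isAut_reflectionPerm P _)

section Basis

variable {Δ : Set ι} (hΔ : IsBasis P Δ)
include hΔ

lemma Word.mul_T {k : ℕ} {n t : G} {w : Equiv.Perm ι} (h : D.Word Δ k n w) (ht : t ∈ D.T) :
    D.Word Δ k (n * t) w := by
  cases h with
  | nil hs => exact .nil (mul_mem hs ht)
  | cons h hα hm =>
    rw [mul_assoc]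
    exact .cons h hα (mul_T_mem_M hΔ hm ht)

lemma exists_word {p : G × Equiv.Perm ι} (hp : p ∈ D.lifts Δ) : ∃ k, D.Word Δ k p.1 p.2 := by
  induction hp using Subgroup.closure_induction_right with
  | one => exact ⟨0, .nil D.T.one_mem⟩
  | mul_right p _ q hq h =>
    obtain ⟨k, h⟩ := h
    rcases hq with ⟨h1, h2⟩ | ⟨α, hα, h1, h2⟩
    · refine ⟨k, ?_⟩
      rw [Prod.snd_mul, h2, mul_one]
      exact h.mul_T hΔ h1
    · refine ⟨k + 1, ?_⟩
      rw [Prod.snd_mul, h2]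
      exact h.cons hα h1
  | mul_inv_cancel p _ q hq h =>
    obtain ⟨k, h⟩ := h
    rcases hq with ⟨h1, h2⟩ | ⟨α, hα, h1, h2⟩
    · refine ⟨k, ?_⟩
      rw [Prod.snd_mul, Prod.snd_inv, h2, inv_one, mul_one]
      exact h.mul_T hΔ (inv_mem h1)
    · refine ⟨k + 1, ?_⟩
      rw [Prod.snd_mul, Prod.snd_inv, h2, P.reflectionPerm_inv]
      exact h.cons hα (inv_mem_M hΔ h1)

/-- The exchange condition. -/
lemma Word.exchange [Finite ι] [P.IsCrystallographic] {k : ℕ} {n m : G} {w : Equiv.Perm ι} {γ : ι}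
    (h : D.Word Δ k n w) (hγ : γ ∈ posRoots P Δ) (hw : w γ ∉ posRoots P Δ) (hm : m ∈ D.M γ) :
    ∃ j, j + 1 = k ∧ D.Word Δ j (n * m) (w * P.reflectionPerm γ) := by
  induction h generalizing γ m with
  | nil ht => exact absurd hγ hw
  | @cons k n m' w α h hα hm' ih =>
    refine ⟨k, rfl, ?_⟩
    -- On the ray of the last letter, `m' m ∈ T` and that letter cancels. Otherwise `r_α γ` is still
    -- positive, and `n m' m = (n (m' m m'⁻¹)) m'` moves the deletion into the shorter word.
    by_cases hr : γ ∈ ray P α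
    · rw [M_of_mem_ray hΔ hr] at hm
      rw [reflectionPerm_eq_of_mem_ray hr, mul_assoc, mul_assoc, ← sq, P.reflectionPerm_sq, mul_one]
      exact h.mul_T hΔ (mul_mem_T hΔ hm' hm)
    · obtain ⟨j, rfl, hj⟩ := ih (hΔ.reflectionPerm_mem ⟨α, hα⟩ ⟨hγ, hr⟩).1 hw
        (conj_M_mem_M hΔ (acts_of_mem_M hm') (isAut_reflectionPerm P α)
          (fun t ht => conj_T_mem_T hΔ hm' ht) hm)
      have := hj.cons hα hm'
      rwa [mul_assoc w, show P.reflectionPerm (P.reflectionPerm α γ) * P.reflectionPerm α =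
        P.reflectionPerm α * P.reflectionPerm γ from reflectionPerm_conj_mul α γ, ← mul_assoc w,
        show n * (m' * m * m'⁻¹) * m' = n * m' * m by group] at this

/-- Let `α` be the last letter. Since the whole word keeps `α` positive, the word without that
letter makes `α` negative, so exchange shortens the word by two letters. -/
lemma mem_T_of_word [Finite ι] [P.IsCrystallographic] {k : ℕ} {n : G} {w : Equiv.Perm ι}
    (h : D.Word Δ k n w) (hw : ∀ γ ∈ posRoots P Δ, w γ ∈ posRoots P Δ) : n ∈ D.T := by
  induction k using Nat.strong_induction_on generalizing n w with
  | _ k ih =>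
    cases h with
    | nil ht => exact ht
    | @cons k n m w α h hα hm =>
      obtain ⟨j, rfl, hj⟩ := h.exchange hΔ (mem_posRoots_of_mem hα) (fun hn => by
        have h1 := hw α (mem_posRoots_of_mem hα)
        rw [Equiv.Perm.mul_apply, show P.reflectionPerm α α = neg P α from rfl,
          h.isAut.neg_apply] at h1
        exact hΔ.neg_notMem hn h1) hm
      exact ih j (by omega) hj hw

/-- The elements of the `M_γ` are products of elements of the `M_α` with `α` simple. -/
lemma mem_lifts_basis [Finite ι] [P.IsCrystallographic] (γ : ι) {m : G} (hm : m ∈ D.M γ) :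
    (m, P.reflectionPerm γ) ∈ D.lifts Δ := by
  have key : ∀ γ ∈ posRoots P Δ, ∀ m ∈ D.M γ, (m, P.reflectionPerm γ) ∈ D.lifts Δ := by
    intro γ hγ
    refine hΔ.forall_posRoots (fun Δ γ => ∀ m ∈ D.M γ, (m, P.reflectionPerm γ) ∈ D.lifts Δ)
      ?_ ?_ hγ
    · intro Δ hΔ α hα γ hr m hm
      rw [M_of_mem_ray hΔ hr] at hm
      rw [reflectionPerm_eq_of_mem_ray hr]
      exact mem_lifts_of_mem_M hα hm
    · intro Δ hΔ α hα γ h m hm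
      -- Conjugation by an element of `M_α` carries `M_{r_α δ}` to `M_δ`, so the generators for `r_α
      -- Δ` are words in those for `Δ`.
      refine (Subgroup.closure_le _).2 ?_ (h m hm)
      rintro ⟨m', w'⟩ (⟨h1, h2⟩ | ⟨_, ⟨δ, hδ, rfl⟩, h1, h2⟩)
      · obtain rfl : w' = 1 := h2
        exact mem_lifts_of_mem_T h1
      · obtain rfl : w' = P.reflectionPerm (P.reflectionPerm α δ) := h2
        obtain ⟨x, hx⟩ := D.exists_mem_M α
        have hx' := inv_mem_M hΔ hx
        have h3 := conj_M_mem_M hΔ (acts_of_mem_M hx') (isAut_reflectionPerm P α)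
          (fun t ht => conj_T_mem_T hΔ hx' ht) h1
        rw [P.reflectionPerm_self] at h3
        have h4 := mul_mem (mul_mem (mem_lifts_of_mem_M hα hx) (mem_lifts_of_mem_M hδ h3))
          (inv_mem (mem_lifts_of_mem_M hα hx))
        convert! h4 using 1
        refine Prod.ext ?_ ?_
        · simp only [Prod.fst_mul, Prod.fst_inv]
          group
        · simp only [Prod.snd_mul, Prod.snd_inv]
          rw [← reflectionPerm_conj_mul]
          group
  rcases hΔ.mem_or_neg γ with h | h
  · exact key γ h m hm
  · rw [← reflectionPerm_neg]
    exact key _ h m (by rwa [M_neg D hΔ])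

/-- An element of `N` that preserves the positive roots lies in `T`. -/
theorem mem_T_of_mem_lifts [Finite ι] [P.IsCrystallographic] {S : Set ι}
    {p : G × Equiv.Perm ι} (hp : p ∈ D.lifts S)
    (hw : ∀ γ ∈ posRoots P Δ, p.2 γ ∈ posRoots P Δ) : p.1 ∈ D.T := by
  have h : p ∈ D.lifts Δ := by
    refine (Subgroup.closure_le _).2 ?_ hp
    rintro ⟨m, w⟩ (⟨h1, h2⟩ | ⟨α, -, h1, h2⟩)
    · obtain rfl : w = 1 := h2
      exact mem_lifts_of_mem_T h1
    · obtain rfl : w = P.reflectionPerm α := h2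
      exact mem_lifts_basis hΔ α h1
  obtain ⟨k, hk⟩ := exists_word hΔ h
  exact mem_T_of_word hΔ hk hw

end Basis

/-! ### Unipotent subgroups -/

lemma conj_mem_of_mem_iSup {X : ι → Subgroup G} {S : Set ι} {K : Subgroup G} {n : G}
    (h : ∀ γ ∈ S, ∀ u ∈ X γ, n * u * n⁻¹ ∈ K) {u : G} (hu : u ∈ ⨆ γ ∈ S, X γ) :
    n * u * n⁻¹ ∈ K := by
  have : ⨆ γ ∈ S, X γ ≤ K.comap (MulAut.conj n).toMonoidHom :=
    iSup₂_le fun γ hγ u hu => by simpa using h γ hγ u hu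
  simpa using this hu

omit [AddCommGroup M] [Module ℝ M] [AddCommGroup V] [Module ℝ V] in
lemma mem_biSup {X : ι → Subgroup G} {S : Set ι} {γ : ι} (hγ : γ ∈ S) {u : G} (hu : u ∈ X γ) :
    u ∈ ⨆ γ ∈ S, X γ :=
  Subgroup.mem_iSup_of_mem γ (Subgroup.mem_iSup_of_mem hγ hu)

/-- The commutator relations for a family of subgroups indexed by the roots. -/
def CommRel (P : RootPairing ι ℝ M V) (X : ι → Subgroup G) : Prop :=
  ∀ α β, (∀ c : ℝ, c ≤ 0 → P.root β ≠ c • P.root α) → ∀ x ∈ X α, ∀ y ∈ X β,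
    x * y * x⁻¹ * y⁻¹ ∈ ⨆ γ ∈ openInterval P α β, X γ

variable (D) in
lemma commRel_U : CommRel P D.U := fun α β h _ hx _ hy =>
  D.commutator_le α β (fun c hc => h c hc.le) (Subgroup.commutator_mem_commutator hx hy)

section Basis

variable {Δ : Set ι} (hΔ : IsBasis P Δ)
include hΔ

/-- The hypothesis makes `γ` involve only `α`, so the roots `rγ + sβ` in the commutator keep the
positive coordinate of `β` away from `α`. -/
lemma conj_mem_biSup_diff_ray [P.IsCrystallographic] {X : ι → Subgroup G} (hX : CommRel P X)
    (α : Δ) {γ : ι} (hγ : ∀ δ : Δ, δ ≠ α → hΔ.coord δ (P.root γ) = 0) {x y : G} (hx : x ∈ X γ)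
    (hy : y ∈ ⨆ β ∈ posRoots P Δ \ ray P α, X β) :
    x * y * x⁻¹ ∈ ⨆ β ∈ posRoots P Δ \ ray P α, X β := by
  refine conj_mem_of_mem_iSup (fun β hβ y hy => ?_) hy
  obtain ⟨δ, hd, hp⟩ := (hΔ.mem_diff_ray_iff α).1 hβ
  have h1 := hX γ β (fun c _ h => by
    rw [h, map_smul, hγ δ hd, smul_zero] at hp
    exact hp.false) x hx y hy
  have h2 : openInterval P γ β ⊆ posRoots P Δ \ ray P α := by
    rintro ε ⟨r, s, hr, hs, h⟩
    refine (hΔ.mem_diff_ray_iff α).2 ⟨δ, hd, ?_⟩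
    rw [h, map_add, map_nsmul, map_nsmul, hγ δ hd, smul_zero, zero_add]
    exact nsmul_pos hp hs.ne'
  have h3 : ⨆ ε ∈ openInterval P γ β, X ε ≤ ⨆ β ∈ posRoots P Δ \ ray P α, X β :=
    biSup_mono fun _ h => h2 h
  have h3 := mul_mem (h3 h1) (mem_biSup hβ hy)
  simpa using h3

lemma coord_eq_zero_self (α : Δ) (δ : Δ) (h : δ ≠ α) : hΔ.coord δ (P.root α) = 0 :=
  hΔ.coord_of_ne h.symm

/-- The group attached to the positive roots is the product of the one attached to the positive
roots that are not multiples of the simple root `α`, and of `X_α`. -/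
lemma exists_mul_of_mem_biSup [P.IsCrystallographic] {X : ι → Subgroup G} (hX : CommRel P X)
    (α : Δ) (hα : ∀ γ ∈ ray P α, X γ ≤ X α) {u : G} (hu : u ∈ ⨆ γ ∈ posRoots P Δ, X γ) :
    ∃ a ∈ ⨆ γ ∈ posRoots P Δ \ ray P α, X γ, ∃ b ∈ X α, u = b * a := by
  have hle : X α ≤ Subgroup.normalizer
      ((⨆ γ ∈ posRoots P Δ \ ray P α, X γ : Subgroup G) : Set G) := by
    intro x hx
    rw [Subgroup.mem_normalizer_iff]
    intro y
    refine ⟨conj_mem_biSup_diff_ray hΔ hX α (coord_eq_zero_self hΔ α) hx, fun h => ?_⟩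
    have := conj_mem_biSup_diff_ray hΔ hX α (coord_eq_zero_self hΔ α) (inv_mem hx) h
    convert this using 1
    group
  have h1 : ⨆ γ ∈ posRoots P Δ, X γ ≤ X α ⊔ ⨆ γ ∈ posRoots P Δ \ ray P α, X γ := by
    refine iSup₂_le fun γ hγ => ?_
    by_cases hr : γ ∈ ray P α
    · exact (hα γ hr).trans le_sup_left
    · exact le_trans (le_iSup₂_of_le γ ⟨hγ, hr⟩ le_rfl) le_sup_right
  have h2 := h1 hu
  rw [← SetLike.mem_coe, Subgroup.coe_mul_of_left_le_normalizer_right _ _ hle] at h2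
  obtain ⟨b, hb, a, ha, rfl⟩ := h2
  exact ⟨a, ha, b, hb, rfl⟩

omit hΔ in
lemma U_le_of_mem_ray {α γ : ι} (h : γ ∈ ray P α) : D.U γ ≤ D.U α := by
  rcases h with rfl | h
  · exact le_rfl
  · exact (D.U_two_lt α γ h).le

/-- `U⁺ ∩ U⁻ = 1`, and more precisely `T U⁺ ∩ U⁻ = 1`. -/
lemma eq_one_of_T_mul {t u v : G} (ht : t ∈ D.T) (hu : u ∈ ⨆ γ ∈ posRoots P Δ, D.U γ)
    (hv : v ∈ ⨆ γ ∈ posRoots P Δ, D.U (neg P γ)) (h : t * u = v) : v = 1 := by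
  have : v ∈ ({1} : Set G) := by
    rw [← D.inter_eq Δ hΔ]
    exact ⟨⟨t, ht, u, hu, h⟩, hv⟩
  exact this

/-- Conjugation by an element of `M_α` sends `u` into `U_{-α}` but keeps the other group inside
`U⁺`, and `U⁺ ∩ U⁻ = 1`. -/
lemma inter_biSup_diff_ray [P.IsCrystallographic] (α : Δ) {u : G} (hu : u ∈ D.U α)
    (h : u ∈ ⨆ γ ∈ posRoots P Δ \ ray P α, D.U γ) : u = 1 := by
  obtain ⟨m, hm⟩ := D.exists_mem_M α
  have h1 : m * u * m⁻¹ ∈ ⨆ γ ∈ posRoots P Δ, D.U γ :=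
    conj_mem_of_mem_iSup (fun γ hγ u hu => mem_biSup (hΔ.reflectionPerm_mem α hγ).1
      (conj_M_mem hm hu)) h
  have h2 : m * u * m⁻¹ ∈ ⨆ γ ∈ posRoots P Δ, D.U (neg P γ) :=
    mem_biSup (X := fun γ => D.U (neg P γ)) (mem_posRoots_of_mem α.2) (conj_M_mem hm hu)
  exact conj_eq_one_iff.1 (eq_one_of_T_mul hΔ D.T.one_mem h1 h2 (one_mul _))

omit hΔ in
lemma biSup_negPerm (X : ι → Subgroup G) :
    ⨆ γ ∈ posRoots P (negPerm P '' Δ), X γ = ⨆ γ ∈ posRoots P Δ, X (neg P γ) := by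
  rw [(isAut_negPerm P).posRoots_image, iSup_image]
  rfl

lemma eq_one_of_T_mul' {t u v : G} (ht : t ∈ D.T) (hu : u ∈ ⨆ γ ∈ posRoots P Δ, D.U γ)
    (hv : v ∈ ⨆ γ ∈ posRoots P Δ, D.U (neg P γ)) (h : t * v = u) : u = 1 := by
  refine eq_one_of_T_mul ((isAut_negPerm P).isBasis_image hΔ) ht (u := v) ?_ ?_ h
  · rwa [biSup_negPerm]
  · rw [← biSup_negPerm, ← Set.image_comp,
      show (negPerm P : ι → ι) ∘ negPerm P = id from funext fun γ => neg_neg_index P γ,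
      Set.image_id]
    exact hu

/-- `N ∩ U⁺ U⁻ = 1`. -/
theorem eq_one_of_eq_mul [Finite ι] [P.IsCrystallographic] {n a v : G} (hn : n ∈ D.N)
    (ha : a ∈ ⨆ γ ∈ posRoots P Δ, D.U γ) (hv : v ∈ ⨆ γ ∈ posRoots P Δ, D.U (neg P γ))
    (h : n = a * v) : n = 1 := by
  obtain ⟨w, hw⟩ := exists_lift hn
  have hA := acts_of_mem_lifts hw
  have hT : n ∈ D.T := by
    -- If `n` made `γ > 0` negative, then for `u ∈ U_{-γ}` the element `a⁻¹ (n u n⁻¹) a = v u v⁻¹`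
    -- would lie in `U⁺ ∩ U⁻`, forcing `u = 1`.
    refine mem_T_of_mem_lifts hΔ hw fun γ hγ => ?_
    by_contra hn'
    have h1 := hΔ.neg_mem_iff.2 hn'
    rw [← (isAut_of_mem_lifts hw).neg_apply] at h1
    obtain ⟨u, hu, hu1⟩ := D.exists_ne_one (neg P γ)
    have h2 : a⁻¹ * (n * u * n⁻¹) * a ∈ ⨆ γ ∈ posRoots P Δ, D.U γ :=
      mul_mem (mul_mem (inv_mem ha) (mem_biSup h1 (hA.mem hu))) ha
    have h3 : a⁻¹ * (n * u * n⁻¹) * a ∈ ⨆ γ ∈ posRoots P Δ, D.U (neg P γ) := by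
      have := mul_mem (mul_mem hv (mem_biSup (X := fun γ => D.U (neg P γ)) hγ hu)) (inv_mem hv)
      convert this using 1
      rw [h]
      group
    have h4 := eq_one_of_T_mul hΔ D.T.one_mem h2 h3 (one_mul _)
    exact hu1 (conj_eq_one_iff.1 (conj_eq_one_iff.1
      (show a⁻¹ * (n * u * n⁻¹) * a⁻¹⁻¹ = 1 by rwa [inv_inv])))
  have hc : n⁻¹ * a⁻¹ * n ∈ ⨆ γ ∈ posRoots P Δ, D.U γ := by
    have := conj_mem_of_mem_iSup (n := n⁻¹) (fun γ hγ u hu =>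
      mem_biSup hγ (conj_T_mem (inv_mem hT) hu)) (inv_mem ha)
    simpa using this
  have h1 : v = 1 := eq_one_of_T_mul hΔ hT hc hv (by rw [h]; group)
  rw [h1, mul_one] at h
  rw [h]
  exact eq_one_of_T_mul' hΔ hT ha (one_mem _) (by rw [mul_one, h])

end Basis

end RootGroupDatum

end GroupN

/-! ### Valuations -/

section Valuations

variable {ι : Type u₁} {M : Type u₂} {V : Type u₃}
  [AddCommGroup M] [Module ℝ M] [AddCommGroup V] [Module ℝ V] {P : RootPairing ι ℝ M V}

namespace RootGroupDatum

variable {G : Type u₆} [Group G] {D : RootGroupDatum P G}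
  {R : Type u₄} [AddCommGroup R] [LinearOrder R]

namespace Valuation

/-- The subgroup `U_{α,r}`. -/
def lev (φ : D.Valuation R) (α : ι) (r : R) : Subgroup G := (φ.level_subgroup α r).choose

lemma mem_lev {φ : D.Valuation R} {α : ι} {r : R} {g : G} :
    g ∈ φ.lev α r ↔ ∃ h : g ∈ D.U α, (r : WithTop R) ≤ φ.φ α ⟨g, h⟩ := by
  rw [← SetLike.mem_coe, lev, (φ.level_subgroup α r).choose_spec]
  rfl

lemma lev_le (φ : D.Valuation R) (α : ι) (r : R) : φ.lev α r ≤ D.U α :=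
  fun _ h => (mem_lev.1 h).1

lemma lev_anti (φ : D.Valuation R) (α : ι) {r s : R} (h : r ≤ s) : φ.lev α s ≤ φ.lev α r := by
  intro g hg
  obtain ⟨h1, h2⟩ := mem_lev.1 hg
  exact mem_lev.2 ⟨h1, le_trans (WithTop.coe_le_coe.2 h) h2⟩

/-- `φ_α(u) = r`. -/
def HasVal (φ : D.Valuation R) (α : ι) (u : G) (r : R) : Prop :=
  ∃ h : u ∈ D.U α, φ.φ α ⟨u, h⟩ = r

variable {φ : D.Valuation R} {α : ι} {u v : G} {k r : R}

lemma φ_eq_top_iff (h : u ∈ D.U α) : φ.φ α ⟨u, h⟩ = ⊤ ↔ u = 1 := by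
  have h1 : u ∈ D.level R (φ.φ α) ⊤ ↔ u ∈ ({1} : Set G) := by rw [φ.level_top α]
  rw [Set.mem_singleton_iff] at h1
  rw [← h1, ← top_le_iff]
  exact ⟨fun h2 => ⟨h, h2⟩, fun ⟨_, h2⟩ => h2⟩

variable (φ) in
lemma exists_hasVal (h : u ∈ D.U α) (h1 : u ≠ 1) : ∃ k, φ.HasVal α u k := by
  obtain ⟨k, hk⟩ := WithTop.ne_top_iff_exists.1 (mt (φ_eq_top_iff (φ := φ) h).1 h1)
  exact ⟨k, h, hk.symm⟩

lemma HasVal.mem (h : φ.HasVal α u k) : u ∈ D.U α := h.1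

lemma HasVal.ne_one (h : φ.HasVal α u k) : u ≠ 1 := by
  obtain ⟨h1, h2⟩ := h
  intro h3
  rw [(φ_eq_top_iff h1).2 h3] at h2
  exact WithTop.top_ne_coe h2

lemma HasVal.mem_lev_iff (h : φ.HasVal α u k) : u ∈ φ.lev α r ↔ r ≤ k := by
  obtain ⟨h1, h2⟩ := h
  rw [mem_lev, ← WithTop.coe_le_coe, ← h2]
  exact ⟨fun ⟨_, h⟩ => h, fun h => ⟨h1, h⟩⟩

lemma HasVal.mem_lev (h : φ.HasVal α u k) : u ∈ φ.lev α k := h.mem_lev_iff.2 le_rfl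

lemma hasVal_of_forall (h : u ∈ D.U α) (h1 : u ≠ 1) (h2 : ∀ r, u ∈ φ.lev α r ↔ r ≤ k) :
    φ.HasVal α u k := by
  obtain ⟨l, hl⟩ := φ.exists_hasVal h h1
  have h3 : l ≤ k := (h2 l).1 hl.mem_lev
  have h4 : k ≤ l := hl.mem_lev_iff.1 ((h2 k).2 le_rfl)
  rwa [h4.antisymm h3]

lemma HasVal.inv (h : φ.HasVal α u k) : φ.HasVal α u⁻¹ k :=
  hasVal_of_forall (inv_mem h.mem) (inv_ne_one.2 h.ne_one) fun r => by
    rw [inv_mem_iff, h.mem_lev_iff]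

lemma HasVal.mul (h : φ.HasVal α u k) (hv : v ∈ φ.lev α r) (hr : k < r) :
    φ.HasVal α (u * v) k := by
  have key (s : R) : u * v ∈ φ.lev α s ↔ s ≤ k := by
    refine ⟨fun hs => ?_, fun hs => ?_⟩
    · by_contra! hn
      have h1 := mul_mem (φ.lev_anti α (min_le_left s r) hs)
        (inv_mem (φ.lev_anti α (min_le_right s r) hv))
      rw [mul_inv_cancel_right, h.mem_lev_iff] at h1
      exact absurd h1 (lt_min hn hr).not_ge
    · exact mul_mem (h.mem_lev_iff.2 hs) (φ.lev_anti α (hs.trans hr.le) hv)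
  refine hasVal_of_forall (mul_mem h.mem (φ.lev_le α r hv)) (fun h1 => ?_) key
  have h2 := (key r).1 (h1 ▸ one_mem _)
  exact absurd h2 hr.not_ge

/-- The last axiom of a valuation applies to `a⁻¹ (a m b) b⁻¹ = m` and to `b (a m b)⁻¹ a = m⁻¹`. -/
lemma HasVal.left_right [IsOrderedAddMonoid R] {a m b : G} (hu : φ.HasVal α (a * m * b) k)
    (ha : a ∈ D.U (neg P α)) (hb : b ∈ D.U (neg P α)) (hm : m ∈ D.M α) (hm' : m⁻¹ ∈ D.M α) :
    φ.HasVal (neg P α) a (-k) ∧ φ.HasVal (neg P α) b (-k) := by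
  have key (x y z : G) (hx : x ∈ D.U (neg P α)) (hz : z ∈ D.U (neg P α)) (hy : φ.HasVal α y k)
      (h : x * y * z ∈ D.M α) : φ.HasVal (neg P α) x (-k) := by
    obtain ⟨hy, h2⟩ := hy
    have h1 := φ.add_eq_zero α ⟨y, hy⟩ ⟨x, hx⟩ ⟨z, hz⟩ h
    rw [h2] at h1
    have h3 : φ.φ (neg P α) ⟨x, hx⟩ ≠ ⊤ := by
      intro h
      rw [h, WithTop.top_add] at h1
      exact WithTop.top_ne_zero h1
    obtain ⟨l, hl⟩ := WithTop.ne_top_iff_exists.1 h3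
    rw [← hl, ← WithTop.coe_add, ← WithTop.coe_zero, WithTop.coe_inj] at h1
    exact ⟨hx, by rw [← hl, eq_neg_of_add_eq_zero_left h1]⟩
  constructor
  · have := key a⁻¹ (a * m * b) b⁻¹ (inv_mem ha) (inv_mem hb) hu (by convert hm using 1; group)
    simpa using this.inv
  · exact key b (a * m * b)⁻¹ a hb ha hu.inv (by convert hm' using 1; group)

end Valuation

open Iwasawa.RootGroupDatum.Valuation

variable [P.IsCrystallographic] {A : Type u₅} [AddTorsor (VR P R) A] {φ : D.Valuation R} {o : A}
  {ν : D.N →* affGroup P R A}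

/-! ### Action of `N` on the apartment and on valuations. -/

section Compatible

variable (hν : IsCompatible φ o ν)
include hν

lemma rootMap_nu_of_mem_M {α : ι} {m : G} (hm : m ∈ D.M α) (h : m ∈ D.N) (β : ι) (x y : A) :
    rootMap P R (P.reflectionPerm α β)
      ((ν ⟨m, h⟩ : Equiv.Perm A) x -ᵥ (ν ⟨m, h⟩ : Equiv.Perm A) y) = rootMap P R β (x -ᵥ y) := by
  have h1 := hν.linear_eq α m hm (x -ᵥ y) y
  rw [vsub_vadd] at h1
  rw [h1, vadd_vsub, rootMap_reflectionMap]

lemma rootMap_nu {S : Set ι} {p : G × Equiv.Perm ι} (hp : p ∈ D.lifts S) (h : p.1 ∈ D.N)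
    (β : ι) (x y : A) : rootMap P R (p.2 β)
      ((ν ⟨p.1, h⟩ : Equiv.Perm A) x -ᵥ (ν ⟨p.1, h⟩ : Equiv.Perm A) y) =
        rootMap P R β (x -ᵥ y) := by
  induction hp using Subgroup.closure_induction generalizing β x y with
  | mem p hp =>
    obtain ⟨t, w⟩ := p
    rcases hp with ⟨h1, h2⟩ | ⟨α, -, h1, h2⟩
    · obtain rfl : w = 1 := h2
      -- Compatibility prescribes linear parts only on the `M_α`; for `t` it is applied to `t m` and
      -- `m` with `m ∈ M_β`.
      obtain ⟨m, hm⟩ := D.exists_mem_M β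
      have hmN := D.mem_N hm
      have h3 := rootMap_nu_of_mem_M hν (T_mul_mem_M hm h1) (mul_mem h hmN) (neg P β)
        ((ν ⟨m, hmN⟩)⁻¹.1 x) ((ν ⟨m, hmN⟩)⁻¹.1 y)
      have h4 := rootMap_nu_of_mem_M hν hm hmN (neg P β)
        ((ν ⟨m, hmN⟩)⁻¹.1 x) ((ν ⟨m, hmN⟩)⁻¹.1 y)
      rw [reflectionPerm_neg_self] at h3 h4
      rw [← h4, show (⟨t * m, mul_mem h hmN⟩ : D.N) = ⟨t, h⟩ * ⟨m, hmN⟩ from rfl, map_mul] at h3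
      simpa using h3
    · obtain rfl : w = P.reflectionPerm α := h2
      exact rootMap_nu_of_mem_M hν h1 h β x y
  | one =>
    rw [show (⟨(1 : G × Equiv.Perm ι).1, h⟩ : D.N) = 1 from rfl, map_one]
    rfl
  | mul p q hp hq ihp ihq =>
    have h1 := mem_N_of_mem_lifts hp
    have h2 := mem_N_of_mem_lifts hq
    rw [show (⟨(p * q).1, h⟩ : D.N) = ⟨p.1, h1⟩ * ⟨q.1, h2⟩ from rfl, map_mul]
    exact (ihp h1 (q.2 β) _ _).trans (ihq h2 β x y)
  | inv p hp ihp =>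
    have h1 := mem_N_of_mem_lifts hp
    rw [show (⟨p⁻¹.1, h⟩ : D.N) = ⟨p.1, h1⟩⁻¹ from rfl, map_inv, ← ihp h1]
    simp

lemma rootMap_nu_T {t : G} (ht : t ∈ D.T) (h : t ∈ D.N) (β : ι) (x y : A) : rootMap P R β
    ((ν ⟨t, h⟩ : Equiv.Perm A) x -ᵥ (ν ⟨t, h⟩ : Equiv.Perm A) y) = rootMap P R β (x -ᵥ y) :=
  rootMap_nu hν (mem_lifts_of_mem_T (S := Set.univ) ht) h β x y

/-- An element of `T` preserves root values of differences, so its displacement has the same root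
values at every point; one fixed point is enough. -/
lemma nu_eq_one [Finite ι] [P.IsRootSystem] [Module.IsTorsionFree ℤ R] {t : G} (ht : t ∈ D.T)
    (h : t ∈ D.N) {x : A} (hx : ∀ γ, rootMap P R γ ((ν ⟨t, h⟩ : Equiv.Perm A) x -ᵥ x) = 0) :
    ν ⟨t, h⟩ = 1 := by
  ext y
  have h1 : (ν ⟨t, h⟩ : Equiv.Perm A) y -ᵥ y = 0 := by
    refine eq_zero_of_rootMap_eq_zero fun γ => ?_
    have h2 := rootMap_nu_T hν ht h γ y x
    have h3 : (ν ⟨t, h⟩ : Equiv.Perm A) y -ᵥ y =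
        ((ν ⟨t, h⟩ : Equiv.Perm A) y -ᵥ (ν ⟨t, h⟩ : Equiv.Perm A) x) - (y -ᵥ x) +
          ((ν ⟨t, h⟩ : Equiv.Perm A) x -ᵥ x) := by
      rw [sub_add_eq_add_sub, vsub_add_vsub_cancel, vsub_sub_vsub_cancel_right]
    rw [h3, map_add, map_sub, h2, sub_self, hx γ, zero_add]
  simpa using vsub_eq_zero_iff_eq.1 h1

lemma two_smul_add_rootMap [IsOrderedAddMonoid R] {α : ι} {a m b : G} {k : R}
    (hu : φ.HasVal α (a * m * b) k)
    (ha : a ∈ D.U (neg P α)) (hb : b ∈ D.U (neg P α)) (hm : m ∈ D.M α) (h : m ∈ D.N) :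
    rootMap P R α ((ν ⟨m, h⟩ : Equiv.Perm A) o -ᵥ o) = -(2 • k) := by
  obtain ⟨h1, h2⟩ := hu
  have h3 : a⁻¹ * (a * m * b) * b⁻¹ = m := by group
  have h4 := hν.two_smul_add α ⟨_, h1⟩ (fun h => (HasVal.ne_one ⟨h1, h2⟩) (congrArg Subtype.val h))
    ⟨a⁻¹, inv_mem ha⟩ ⟨b⁻¹, inv_mem hb⟩ (by rwa [h3])
  simp only [h3, h2] at h4
  have h5 : 2 • k + rootAt P R o α ((ν ⟨m, h⟩ : Equiv.Perm A) o) = 0 := by exact_mod_cast h4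
  exact (neg_eq_of_add_eq_zero_right h5).symm

/-- Twice the valuation of `u` is read off from the displacement of `o` by `m(u)`. Conjugating `u`
conjugates `m(u)`, which gives the formula up to a factor `2`; `R` is torsion-free. -/
lemma hasVal_conj [IsOrderedAddMonoid R] {Δ : Set ι} (hΔ : IsBasis P Δ) {S : Set ι} {n : G}
    {w : Equiv.Perm ι} (hn : (n, w) ∈ D.lifts S) (h : n ∈ D.N) {β : ι} {u : G} {k : R}
    (hT : ∀ t ∈ D.T, n * t * n⁻¹ ∈ D.T)
    (hu : φ.HasVal β u k) : φ.HasVal (w β) (n * u * n⁻¹)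
      (k + rootMap P R β (((ν ⟨n, h⟩)⁻¹ : affGroup P R A).1 o -ᵥ o)) := by
  have hA := acts_of_mem_lifts hn
  have hw := isAut_of_mem_lifts hn
  obtain ⟨k', hk'⟩ := φ.exists_hasVal (hA.mem hu.mem) (mt conj_eq_one_iff.1 hu.ne_one)
  obtain ⟨a, ha, m, hm, b, hb, rfl⟩ := exists_eq_mul' hu.mem hu.ne_one
  rw [M_neg D hΔ] at hm
  have hm' := conj_M_mem_M hΔ hA hw hT hm
  have ha' := hA.mem ha
  have hb' := hA.mem hb
  rw [hw.neg_apply] at ha' hb'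
  have hmN := D.mem_N hm
  have h1 := two_smul_add_rootMap hν hu ha hb hm hmN
  have h2 := two_smul_add_rootMap hν (a := n * a * n⁻¹) (m := n * m * n⁻¹) (b := n * b * n⁻¹)
    (by convert hk' using 1; group) ha' hb' hm' (D.mem_N hm')
  set z := ((ν ⟨n, h⟩)⁻¹ : affGroup P R A).1 o with hz
  have hnz : (ν ⟨n, h⟩ : Equiv.Perm A) z = o := by simp [hz]
  have h3 : (ν ⟨n * m * n⁻¹, D.mem_N hm'⟩ : Equiv.Perm A) o =
      (ν ⟨n, h⟩ : Equiv.Perm A) ((ν ⟨m, hmN⟩ : Equiv.Perm A) z) := by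
    rw [show (⟨n * m * n⁻¹, D.mem_N hm'⟩ : D.N) = ⟨n, h⟩ * ⟨m, hmN⟩ * ⟨n, h⟩⁻¹ from rfl,
      map_mul, map_mul, map_inv]
    rfl
  have h4 := rootMap_nu hν hn h β ((ν ⟨m, hmN⟩ : Equiv.Perm A) z) z
  simp only [hnz] at h4
  rw [h3, h4] at h2
  have h5 := rootMap_nu_of_mem_M hν hm hmN (neg P β) z o
  rw [reflectionPerm_neg_self, rootMap_neg] at h5
  have h6 : (ν ⟨m, hmN⟩ : Equiv.Perm A) z -ᵥ z =
      ((ν ⟨m, hmN⟩ : Equiv.Perm A) z -ᵥ (ν ⟨m, hmN⟩ : Equiv.Perm A) o) +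
        ((ν ⟨m, hmN⟩ : Equiv.Perm A) o -ᵥ o) - (z -ᵥ o) := by
    rw [vsub_add_vsub_cancel, vsub_sub_vsub_cancel_right]
  rw [h6, map_sub, map_add, h5, h1] at h2
  have h7 : 2 • (k + rootMap P R β (z -ᵥ o)) = 2 • k' := by
    rw [smul_add, ← neg_inj, ← h2, _root_.two_smul _ (rootMap P R β (z -ᵥ o))]
    abel
  have h8 : k + rootMap P R β (z -ᵥ o) = k' := nsmul_right_injective two_ne_zero h7
  rwa [h8]

lemma hasVal_conj_T [IsOrderedAddMonoid R] {Δ : Set ι} (hΔ : IsBasis P Δ) {t : G} (ht : t ∈ D.T)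
    (h : t ∈ D.N) {β : ι} {u : G} {k : R} (hu : φ.HasVal β u k) : φ.HasVal β (t * u * t⁻¹)
      (k + rootMap P R β (o -ᵥ (ν ⟨t, h⟩ : Equiv.Perm A) o)) := by
  have h1 := hasVal_conj hν hΔ (mem_lifts_of_mem_T (S := Set.univ) ht) h
    (fun s hs => mul_mem (mul_mem ht hs) (inv_mem ht)) hu
  have h2 := rootMap_nu_T hν ht h β (((ν ⟨t, h⟩)⁻¹ : affGroup P R A).1 o) o
  rw [← h2] at h1
  simpa using h1

end Compatible

end RootGroupDatum

end Valuations

/-! ### Groups generated by two opposite root groups -/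

section RankOne

variable {ι : Type u₁} {M : Type u₂} {V : Type u₃}
  [AddCommGroup M] [Module ℝ M] [AddCommGroup V] [Module ℝ V] {P : RootPairing ι ℝ M V}

namespace RootGroupDatum

open Iwasawa.RootGroupDatum.Valuation

variable {G : Type u₆} [Group G] {D : RootGroupDatum P G}
  {R : Type u₄} [AddCommGroup R] [LinearOrder R] [IsOrderedAddMonoid R]

/-! ### Stability of the filtration of a simple root group. -/

section Strings

variable (φ : D.Valuation R)

/-- The groups `U_{γ,rb+jk}` for the roots `γ = rβ + jα` with `r > 0` and `j` in a set `J`. -/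
def stringSet (α β : ι) (k b : R) (J : Set ℤ) : Set G :=
  {g | ∃ (γ : ι) (r : ℕ) (j : ℤ), 0 < r ∧ j ∈ J ∧ P.root γ = r • P.root β + j • P.root α ∧
    g ∈ φ.lev γ (r • b + j • k)}

variable {φ}

/-- Used with `δ` equal to `α`, `-α` or `β`. The bound `hk` makes `U_{δ,k'}` at least as deep as the
level that the string rule would give to `δ`, so the levels of commutators obey that rule too. -/
lemma commutator_mem_stringSet {α β : ι} {k k' b : R} {J : Set ℤ} {ρ : ℕ} {ε : ℤ} {δ : ι}
    (hδ : P.root δ = ρ • P.root β + ε • P.root α)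
    (hc : ∀ r : ℕ, 0 < r → ∀ j ∈ J, ∀ c : ℝ, c ≤ 0 →
      r • P.root β + j • P.root α ≠ c • P.root δ)
    (hJ : ∀ j ∈ J, ∀ p q : ℕ, 0 < q → q • j + p • ε ∈ J)
    (hk : ρ • b + ε • k ≤ k') {x y : G} (hx : x ∈ φ.lev δ k') (hy : y ∈ stringSet φ α β k b J) :
    x * y * x⁻¹ * y⁻¹ ∈ Subgroup.closure (stringSet φ α β k b J) := by
  obtain ⟨γ, r, j, hr, hj, hγ, hy⟩ := hy
  have h1 := φ.commutator_mem δ γ (hγ ▸ hc r hr j hj) k' _ x y (mem_lev.1 hx) (mem_lev.1 hy)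
  refine Subgroup.closure_mono ?_ h1
  rintro g ⟨p, q, η, hp, hq, hη, hg⟩
  refine ⟨η, q * r + p * ρ, q • j + p • ε, by positivity, hJ j hj p q hq, ?_, φ.lev_anti η ?_
    (mem_lev.2 hg)⟩
  · rw [hη, hδ, hγ]
    module
  · have h2 : (q * r + p * ρ) • b + (q • j + p • ε) • k =
        p • (ρ • b + ε • k) + q • (r • b + j • k) := by
      module
    rw [h2]
    exact add_le_add_left (nsmul_le_nsmul_right hk p) _

omit [IsOrderedAddMonoid R] [AddCommGroup R] [LinearOrder R] in
lemma le_normalizer_closure {K : Subgroup G} {S : Set G}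
    (h : ∀ x ∈ K, ∀ y ∈ S, x * y * x⁻¹ * y⁻¹ ∈ Subgroup.closure S) :
    K ≤ Subgroup.normalizer (Subgroup.closure S : Set G) := by
  have key : ∀ x ∈ K, ∀ y ∈ Subgroup.closure S, x * y * x⁻¹ ∈ Subgroup.closure S := by
    intro x hx y hy
    have : Subgroup.closure S ≤ (Subgroup.closure S).comap (MulAut.conj x).toMonoidHom := by
      rw [Subgroup.closure_le]
      intro y hy
      have := mul_mem (h x hx y hy) (Subgroup.subset_closure hy)
      simpa using this
    simpa using this hy
  intro x hx
  rw [Subgroup.mem_normalizer_iff]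
  refine fun y => ⟨key x hx y, fun h => ?_⟩
  have := key _ (inv_mem hx) _ h
  convert this using 1
  group

variable {Δ : Set ι} (hΔ : IsBasis P Δ) {α β : Δ} (hαβ : β ≠ α)
include hΔ hαβ

/-- An element of the group generated by `U_{α,k}` and `U_{-α,l}`, where `k + l ≥ 0`, that
normalizes `U_β`, stabilizes the `U_{β,b}`. Here `α` and `β` belong to a basis. -/
lemma conj_mem_lev [P.IsCrystallographic] {k l b : R} (hkl : 0 ≤ k + l) {x y : G}
    (hx : x ∈ φ.lev (α : ι) k ⊔ φ.lev (neg P α) l)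
    (hy : y ∈ φ.lev (β : ι) b) (hxy : x * y * x⁻¹ ∈ D.U (β : ι)) :
    x * y * x⁻¹ ∈ φ.lev (β : ι) b := by
  set S := stringSet φ (α : ι) β k b Set.univ with hS
  set S' := stringSet φ (α : ι) β k b {0}ᶜ with hS'
  have hcβ (r : ℕ) (j : ℤ) : hΔ.coord β (r • P.root β + j • P.root α) = r := by
    simp [hΔ.coord_of_ne hαβ.symm]
  have hcα (r : ℕ) (j : ℤ) : hΔ.coord α (r • P.root β + j • P.root α) = j := by
    simp [hΔ.coord_of_ne hαβ]
  have hne (ε : ℤ) (r : ℕ) (hr : 0 < r) (j : ℤ) (c : ℝ) :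
      r • P.root β + j • P.root α ≠ c • (ε • P.root α) := by
    intro h
    have h1 := congrArg (hΔ.coord β) h
    rw [hcβ, map_smul, map_zsmul, hΔ.coord_of_ne hαβ.symm, smul_zero, smul_zero] at h1
    exact hr.ne' (by exact_mod_cast h1)
  have hle : φ.lev (α : ι) k ⊔ φ.lev (neg P α) l ≤
      Subgroup.normalizer (Subgroup.closure S : Set G) := by
    refine sup_le (le_normalizer_closure fun x hx s hs => ?_)
      (le_normalizer_closure fun x hx s hs => ?_)
    · exact commutator_mem_stringSet (ρ := 0) (ε := 1) (by simp)
        (fun r hr j _ c _ => by simpa using hne 1 r hr j c) (by simp) (by simp) hx hs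
    · exact commutator_mem_stringSet (ρ := 0) (ε := -1) (by simp)
        (fun r hr j _ c _ => by simpa using hne (-1) r hr j c) (by simp)
        (by rw [zero_smul, zero_add, neg_one_smul]; exact neg_le_iff_add_nonneg'.2 hkl) hx hs
  have h1 : x * y * x⁻¹ ∈ Subgroup.closure S := by
    refine (Subgroup.mem_normalizer_iff.1 (hle hx) y).1 (Subgroup.subset_closure ?_)
    exact ⟨β, 1, 0, one_pos, Set.mem_univ _, by simp, by simpa using hy⟩
  have hnorm : φ.lev (β : ι) b ≤ Subgroup.normalizer (Subgroup.closure S' : Set G) := by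
    refine le_normalizer_closure fun x hx s hs => ?_
    refine commutator_mem_stringSet (ρ := 1) (ε := 0) (by simp) (fun r hr j hj c _ h => ?_)
      (fun j hj p q hq => ?_) (by simp) hx hs
    · have h1 := congrArg (hΔ.coord α) h
      rw [hcα, map_smul, hΔ.coord_of_ne hαβ, smul_zero] at h1
      exact hj (by exact_mod_cast h1)
    · simpa [hq.ne'] using hj
  -- The strings with `j = 0` belong to `β` and `2β` and lie in `U_{β,b}`, which normalizes the
  -- group generated by the others.
  have hSle : Subgroup.closure S ≤ φ.lev (β : ι) b ⊔ Subgroup.closure S' := by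
    rw [Subgroup.closure_le]
    rintro g ⟨γ, r, j, hr, -, hγ, hg⟩
    by_cases hj : j = 0
    · subst hj
      rw [zero_smul, add_zero] at hγ hg
      refine Subgroup.mem_sup_left ?_
      rcases mem_ray_of_eq_nsmul hγ with rfl | h2
      · have hr1 : r = 1 := by
          have h1 := congrArg (hΔ.coord β) hγ
          rw [map_nsmul, hΔ.coord_self] at h1
          simpa [eq_comm] using h1
        simpa [hr1] using hg
      · have hr2 : r = 2 := by
          have h1 := congrArg (hΔ.coord β) (h2.symm.trans hγ)
          rw [map_nsmul, map_nsmul, hΔ.coord_self] at h1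
          have h3 : (2 : ℝ) = r := by simpa using h1
          exact_mod_cast h3.symm
        subst hr2
        obtain ⟨h3, h4⟩ := mem_lev.1 hg
        have h5 := U_le_of_mem_ray (D := D) (Or.inr h2) h3
        refine mem_lev.2 ⟨h5, ?_⟩
        rw [φ.two_smul (β : ι) γ h2 g h3 h5] at h4
        by_cases hg1 : g = 1
        · rw [(φ_eq_top_iff h5).2 hg1]
          exact le_top
        · obtain ⟨c, h6, h7⟩ := φ.exists_hasVal h5 hg1
          rw [h7] at h4 ⊢
          have h8 : 2 • b ≤ 2 • c := by exact_mod_cast h4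
          exact_mod_cast (nsmul_le_nsmul_iff_right two_ne_zero).1 h8
    · exact Subgroup.mem_sup_right (Subgroup.subset_closure ⟨γ, r, j, hr, hj, hγ, hg⟩)
  have h2 := hSle h1
  rw [← SetLike.mem_coe, Subgroup.coe_mul_of_left_le_normalizer_right _ _ hnorm] at h2
  obtain ⟨c, hc, s, hs, hcs⟩ := h2
  -- The factor `s` is in `U_β` by the hypothesis on `x y x⁻¹`, and in the group of the positive
  -- roots outside the ray of `β`.
  have hs1 : s = 1 := by
    refine inter_biSup_diff_ray (D := D) hΔ β ?_ ?_
    · have : s = c⁻¹ * (x * y * x⁻¹) := by rw [← hcs]; group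
      rw [this]
      exact mul_mem (inv_mem (φ.lev_le _ _ hc)) hxy
    · refine (Subgroup.closure_le _).2 ?_ hs
      rintro g ⟨γ, r, j, hr, hj, hγ, hg⟩
      have hγ' : γ ∈ posRoots P Δ \ ray P β := by
        refine ⟨hΔ.mem_of_coord_pos β ?_, fun hr => hj ?_⟩
        · rw [hγ, hcβ]
          exact_mod_cast hr
        · have h3 := hΔ.coord_of_mem_ray hr hαβ.symm
          rw [hγ, hcα] at h3
          exact_mod_cast h3
      exact mem_biSup (X := D.U) hγ' (φ.lev_le _ _ hg)
  rw [← hcs, hs1]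
  simpa using hc

end Strings

section Compatible

variable [P.IsCrystallographic] {A : Type u₅} [AddTorsor (VR P R) A] {φ : D.Valuation R} {o : A}
  {ν : D.N →* affGroup P R A} (hν : IsCompatible φ o ν) {Δ : Set ι} (hΔ : IsBasis P Δ)
include hΔ

include hν in
-- Write `u = v₁ m v₂`. Since `φ(v₂) = -k < l`, the product `v₂ v` still has valuation `-k` and
-- equals `u₁ m' u₂` with `φ(u₂) = k`. Moving `u₁` across `m` gives `t = m m'`, and the
-- `α`-displacements of `m` and `m'` cancel.
lemma exists_mul_eq_of_pos {α : ι} {u v : G} {k l : R} (hu : φ.HasVal α u k)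
    (hv : φ.HasVal (neg P α) v l) (hkl : 0 < k + l) :
    ∃ v' ∈ D.U (neg P α), ∃ t, ∃ ht : t ∈ D.T, ∃ u', φ.HasVal α u' k ∧ u * v = v' * t * u' ∧
      rootMap P R α ((ν ⟨t, mem_N_of_mem_T ht⟩ : Equiv.Perm A) o -ᵥ o) = 0 := by
  obtain ⟨v₁, hv₁, m, hm, v₂, hv₂, rfl⟩ := exists_eq_mul' hu.mem hu.ne_one
  rw [M_neg D hΔ] at hm
  have hvals := hu.left_right hv₁ hv₂ hm (inv_mem_M hΔ hm)
  have hvv : φ.HasVal (neg P α) (v₂ * v) (-k) :=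
    hvals.2.mul hv.mem_lev (neg_lt_iff_pos_add'.2 hkl)
  obtain ⟨u₁, hu₁, m', hm', u₂, hu₂, he⟩ := exists_eq_mul' hvv.mem hvv.ne_one
  rw [he] at hvv
  rw [neg_neg_index] at hm'
  have hm₂ : m' ∈ D.M (neg P α) := by rwa [M_neg D hΔ]
  have hvals' := hvv.left_right hu₁ hu₂ hm₂ (inv_mem_M hΔ hm₂)
  rw [_root_.neg_neg, neg_neg_index] at hvals'
  have h1 := two_smul_add_rootMap hν hu hv₁ hv₂ hm (D.mem_N hm)
  have h2 := two_smul_add_rootMap hν hvv hu₁ hu₂ hm₂ (D.mem_N hm')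
  refine ⟨v₁ * (m * u₁ * m⁻¹), mul_mem hv₁ (conj_M_mem hm hvals'.1.mem), m * m',
    mul_mem_T hΔ hm hm', u₂, hvals'.2, ?_, ?_⟩
  · rw [mul_assoc, he]
    group
  · have h3 := rootMap_nu_of_mem_M hν hm (D.mem_N hm) (neg P α)
      ((ν ⟨m', D.mem_N hm'⟩ : Equiv.Perm A) o) o
    rw [reflectionPerm_neg_self, h2] at h3
    have h4 : (ν ⟨m * m', mem_N_of_mem_T (mul_mem_T hΔ hm hm')⟩ : Equiv.Perm A) o =
        (ν ⟨m, D.mem_N hm⟩ : Equiv.Perm A) ((ν ⟨m', D.mem_N hm'⟩ : Equiv.Perm A) o) := by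
      rw [show (⟨m * m', mem_N_of_mem_T (mul_mem_T hΔ hm hm')⟩ : D.N) =
        ⟨m, D.mem_N hm⟩ * ⟨m', D.mem_N hm'⟩ from rfl, map_mul]
      rfl
    rw [h4, ← vsub_add_vsub_cancel _ ((ν ⟨m, D.mem_N hm⟩ : Equiv.Perm A) o) o, map_add, h3, h1]
    simp

omit [P.IsCrystallographic] in
lemma eq_of_mul_eq {α : Δ} {v t u v' t' u' : G} (hv : v ∈ D.U (neg P α))
    (hv' : v' ∈ D.U (neg P α)) (ht : t ∈ D.T) (ht' : t' ∈ D.T) (hu : u ∈ D.U (α : ι))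
    (hu' : u' ∈ D.U (α : ι)) (h : v * t * u = v' * t' * u') : v = v' := by
  have h1 : v'⁻¹ * v = t' * (u' * u⁻¹) * t⁻¹ := by
    have : v = v' * t' * u' * u⁻¹ * t⁻¹ := by rw [← h]; group
    rw [this]
    group
  have hp (x : G) (hx : x ∈ D.U (α : ι)) : x ∈ ⨆ γ ∈ posRoots P Δ, D.U γ :=
    mem_biSup (mem_posRoots_of_mem α.2) hx
  have h2 : v'⁻¹ * v ∈ ⨆ γ ∈ posRoots P Δ, D.U (neg P γ) :=
    mem_biSup (X := fun γ => D.U (neg P γ)) (mem_posRoots_of_mem α.2) (mul_mem (inv_mem hv') hv)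
  have h3 : v'⁻¹ * v = 1 := by
    refine eq_one_of_T_mul hΔ (mul_mem ht' (inv_mem ht))
      (hp _ (conj_T_mem ht (mul_mem hu' (inv_mem hu)))) h2 ?_
    rw [h1]
    group
  exact (inv_mul_eq_one.1 h3).symm

include hν in
/-- If `u ∈ U_α` and `v ∈ U_{-α}` satisfy `φ_α(u) + φ_{-α}(v) > 0`, then `u v = v' t u'` where `v'`
and `u'` have the same valuations as `v` and `u`, and `t` acts trivially on the apartment. -/
theorem exists_mul_eq [Finite ι] [P.IsRootSystem] {α : Δ} {u v : G} {k l : R}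
    (hu : φ.HasVal (α : ι) u k) (hv : φ.HasVal (neg P α) v l) (hkl : 0 < k + l) :
    ∃ v', φ.HasVal (neg P α) v' l ∧ ∃ t, ∃ ht : t ∈ D.T, ν ⟨t, mem_N_of_mem_T ht⟩ = 1 ∧
      ∃ u', φ.HasVal (α : ι) u' k ∧ u * v = v' * t * u' := by
  obtain ⟨v', hv', t, ht, u', hu', he, h0⟩ := exists_mul_eq_of_pos hν hΔ hu hv hkl
  -- Factoring `v⁻¹ u⁻¹` and inverting gives a second factorization of `u v`, now with control of
  -- the valuation in `U_{-α}`. Uniqueness of the `U_{-α}` factor transfers it to `v'`.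
  have hu2 : φ.HasVal (neg P (neg P α)) u⁻¹ k := by
    rw [neg_neg_index]
    exact hu.inv
  obtain ⟨u₁, hu₁, s, hs, v₁, hv₁, he₁, -⟩ := exists_mul_eq_of_pos hν hΔ hv.inv hu2
    (by rwa [add_comm])
  rw [neg_neg_index] at hu₁
  have hv'₁ : v' = v₁⁻¹ := by
    refine eq_of_mul_eq hΔ hv' (inv_mem hv₁.mem) ht (inv_mem hs) hu'.mem (inv_mem hu₁) ?_
    rw [← he, ← inv_inj, mul_inv_rev, he₁]
    group
  have hvl : φ.HasVal (neg P α) v' l := hv'₁ ▸ hv₁.inv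
  refine ⟨v', hvl, t, ht, ?_, u', hu', he⟩
  have htmem : t ∈ φ.lev (α : ι) k ⊔ φ.lev (neg P α) l := by
    have h1 : t = v'⁻¹ * (u * v) * u'⁻¹ := by rw [he]; group
    have hp {x : G} (hx : φ.HasVal (α : ι) x k) : x ∈ φ.lev (α : ι) k ⊔ φ.lev (neg P α) l :=
      Subgroup.mem_sup_left hx.mem_lev
    have hq {x : G} (hx : φ.HasVal (neg P α) x l) : x ∈ φ.lev (α : ι) k ⊔ φ.lev (neg P α) l :=
      Subgroup.mem_sup_right hx.mem_lev
    rw [h1]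
    exact mul_mem (mul_mem (inv_mem (hq hvl)) (mul_mem (hp hu) (hq hv))) (inv_mem (hp hu'))
  refine nu_eq_one hν ht _ (x := o) (rootMap_eq_zero_of_basis hΔ fun β hβ => ?_)
  by_cases hαβ : (⟨β, hβ⟩ : Δ) = α
  · rw [← hαβ] at h0
    exact h0
  -- Conjugation by `s` shifts valuations on `U_β` by this amount and preserves the filtration, so
  -- the shift is nonnegative. Taking `s = t` and `s = t⁻¹` gives opposite inequalities.
  have key (s : G) (hs : s ∈ D.T) (hs' : s ∈ φ.lev (α : ι) k ⊔ φ.lev (neg P α) l) :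
      0 ≤ rootMap P R β (o -ᵥ (ν ⟨s, mem_N_of_mem_T hs⟩ : Equiv.Perm A) o) := by
    obtain ⟨y, hy, hy1⟩ := D.exists_ne_one β
    obtain ⟨b, hb⟩ := φ.exists_hasVal hy hy1
    have h1 := hasVal_conj_T hν hΔ hs (mem_N_of_mem_T hs) hb
    have h2 := conj_mem_lev hΔ (β := ⟨β, hβ⟩) hαβ hkl.le hs' hb.mem_lev h1.mem
    simpa using h1.mem_lev_iff.1 h2
  have h1 := key t ht htmem
  have h2 := key t⁻¹ (inv_mem ht) (inv_mem htmem)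
  have h3 := rootMap_nu_T hν ht (mem_N_of_mem_T ht) β o
    ((ν ⟨t⁻¹, mem_N_of_mem_T (inv_mem ht)⟩ : Equiv.Perm A) o)
  have h4 : (ν ⟨t, mem_N_of_mem_T ht⟩ : Equiv.Perm A)
      ((ν ⟨t⁻¹, mem_N_of_mem_T (inv_mem ht)⟩ : Equiv.Perm A) o) = o := by
    rw [show (⟨t⁻¹, mem_N_of_mem_T (inv_mem ht)⟩ : D.N) = ⟨t, mem_N_of_mem_T ht⟩⁻¹ from rfl,
      map_inv]
    simp
  rw [h4] at h3
  rw [← h3] at h2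
  rw [← neg_vsub_eq_vsub_rev, map_neg] at h1
  exact le_antisymm (neg_nonneg.1 h1) h2

end Compatible

end RootGroupDatum

end RankOne

/-! ### Parahoric subgroups -/

section Parahoric

variable {ι : Type u₁} {M : Type u₂} {V : Type u₃}
  [AddCommGroup M] [Module ℝ M] [AddCommGroup V] [Module ℝ V] {P : RootPairing ι ℝ M V}
  [P.IsCrystallographic]

namespace RootGroupDatum

open Iwasawa.RootGroupDatum.Valuation

variable {G : Type u₆} [Group G] {D : RootGroupDatum P G}
  {R : Type u₄} [AddCommGroup R] [LinearOrder R]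
  {A : Type u₅} [AddTorsor (VR P R) A]

/-- The group `U_{γ,Ω}`. -/
def rootGroupOn (φ : D.Valuation R) (o : A) (Ω : Set A) (γ : ι) : Subgroup G :=
  D.U γ ⊓ ⨅ x ∈ Ω, φ.lev γ (-rootAt P R o γ x)

/-- The elements of `T` that act trivially on the apartment. -/
def actKer (ν : D.N →* affGroup P R A) : Subgroup G := ν.ker.map D.N.subtype ⊓ D.T

/-- The product of the groups attached to a set `S` of roots, to the opposite set, and of `K`. -/
def bigCell (X : ι → Subgroup G) (K : Subgroup G) (S : Set ι) : Set G :=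
  {g | ∃ a ∈ ⨆ γ ∈ S, X γ, ∃ b ∈ ⨆ γ ∈ S, X (neg P γ), ∃ t ∈ K, g = a * b * t}

variable {φ : D.Valuation R} {o : A} {ν : D.N →* affGroup P R A} {Ω : Set A}

lemma mem_rootGroupOn {γ : ι} {g : G} : g ∈ rootGroupOn φ o Ω γ ↔
    g ∈ D.U γ ∧ ∀ x ∈ Ω, g ∈ φ.lev γ (-rootAt P R o γ x) := by
  simp [rootGroupOn, Subgroup.mem_iInf]

lemma Valuation.HasVal.mem_rootGroupOn_iff {γ : ι} {g : G} {k : R} (h : φ.HasVal γ g k) :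
    g ∈ rootGroupOn φ o Ω γ ↔ ∀ x ∈ Ω, -rootAt P R o γ x ≤ k := by
  simp only [mem_rootGroupOn, h.mem_lev_iff, h.mem, true_and]

omit [P.IsCrystallographic] [LinearOrder R] in
lemma mem_actKer {t : G} : t ∈ actKer ν ↔ t ∈ D.T ∧ ∃ h : t ∈ D.N, ν ⟨t, h⟩ = 1 := by
  simp only [actKer, Subgroup.mem_inf, Subgroup.mem_map, MonoidHom.mem_ker, Subgroup.subtype_apply,
    and_comm (b := t ∈ D.T)]
  refine and_congr_right fun _ => ⟨?_, fun ⟨h, h1⟩ => ⟨⟨t, h⟩, h1, rfl⟩⟩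
  rintro ⟨⟨t, h⟩, h1, rfl⟩
  exact ⟨h, h1⟩

lemma rootGroupOn_le_parahoric (γ : ι) : rootGroupOn φ o Ω γ ≤ parahoric φ o ν Ω := by
  intro g hg
  rw [mem_rootGroupOn] at hg
  exact Subgroup.subset_closure (Or.inl (Subgroup.subset_closure
    ⟨γ, hg.1, fun x hx => (mem_lev.1 (hg.2 x hx)).2⟩))

lemma mem_rootGroupOn_of_le {γ : ι} {g : G} (h : g ∈ D.U γ)
    (h' : ∀ x ∈ Ω, ((-rootAt P R o γ x : R) : WithTop R) ≤ φ.φ γ ⟨g, h⟩) :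
    g ∈ rootGroupOn φ o Ω γ :=
  mem_rootGroupOn.2 ⟨h, fun x hx => mem_lev.2 ⟨h, h' x hx⟩⟩

variable [IsOrderedAddMonoid R]

omit [LinearOrder R] [IsOrderedAddMonoid R] in
lemma rootAt_neg (γ : ι) (x : A) : rootAt P R o (neg P γ) x = -rootAt P R o γ x :=
  rootMap_neg γ _

omit [LinearOrder R] [IsOrderedAddMonoid R] in
lemma rootAt_add_nsmul {α β γ : ι} {a b : ℕ} (h : P.root γ = a • P.root α + b • P.root β)
    (x : A) : rootAt P R o γ x = a • rootAt P R o α x + b • rootAt P R o β x := by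
  have := rootMap_add_smul (P := P) (R := R) (a := (a : ℤ)) (b := (b : ℤ))
    (by simpa only [natCast_zsmul] using h) (x -ᵥ o)
  simp only [natCast_zsmul] at this
  exact this

-- The commutator axiom is applied at the exact valuations of `x` and `y`: the supremum over `Ω`
-- that would define a common level need not exist in `R`.
variable (φ o Ω) in
lemma commRel_rootGroupOn : CommRel P (rootGroupOn φ o Ω) := by
  intro α β h x hx y hy
  by_cases hx1 : x = 1
  · simp [hx1]
  by_cases hy1 : y = 1
  · simp [hy1]
  obtain ⟨a, ha⟩ := φ.exists_hasVal (mem_rootGroupOn.1 hx).1 hx1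
  obtain ⟨b, hb⟩ := φ.exists_hasVal (mem_rootGroupOn.1 hy).1 hy1
  rw [ha.mem_rootGroupOn_iff] at hx
  rw [hb.mem_rootGroupOn_iff] at hy
  refine (Subgroup.closure_le _).2 ?_
    (φ.commutator_mem α β h a b x y (mem_lev.1 ha.mem_lev) (mem_lev.1 hb.mem_lev))
  rintro g ⟨r, s, γ, hr, hs, hγ, hg⟩
  have hγ' : γ ∈ openInterval P α β := ⟨r, s, hr, hs, hγ⟩
  refine mem_biSup (X := rootGroupOn φ o Ω) hγ' (mem_rootGroupOn.2
    ⟨hg.1, fun z hz => φ.lev_anti γ ?_ (mem_lev.2 hg)⟩)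
  have h2 := add_le_add (nsmul_le_nsmul_right (hx z hz) r) (nsmul_le_nsmul_right (hy z hz) s)
  rw [rootAt_add_nsmul hγ]
  convert h2 using 1
  simp only [smul_neg]
  abel

lemma rootGroupOn_le_of_mem_ray {α γ : ι} (h : γ ∈ ray P α) :
    rootGroupOn φ o Ω γ ≤ rootGroupOn φ o Ω α := by
  intro g hg
  by_cases hg1 : g = 1
  · rw [hg1]
    exact one_mem _
  have h1 := U_le_of_mem_ray (D := D) h (mem_rootGroupOn.1 hg).1
  obtain ⟨k, hk⟩ := φ.exists_hasVal (mem_rootGroupOn.1 hg).1 hg1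
  obtain ⟨l, hl⟩ := φ.exists_hasVal h1 hg1
  rw [hk.mem_rootGroupOn_iff] at hg
  rw [hl.mem_rootGroupOn_iff]
  rcases h with rfl | h
  · have : (k : WithTop R) = l := hk.2.symm.trans hl.2
    rw [← WithTop.coe_inj.1 this]
    exact hg
  · intro x hx
    have h2 := φ.two_smul α γ h g hk.1 hl.1
    rw [hk.2, hl.2] at h2
    have h3 : k = 2 • l := by exact_mod_cast h2
    have h4 : rootAt P R o γ x = 2 • rootAt P R o α x := by
      simpa using rootAt_add_nsmul (R := R) (o := o) (α := α) (β := α) (γ := γ) (a := 2) (b := 0)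
        (by simpa using h) x
    have h5 := hg x hx
    rw [h3, h4, ← smul_neg] at h5
    exact (nsmul_le_nsmul_iff_right two_ne_zero).1 h5

omit [P.IsCrystallographic] in
lemma CommRel.comp_neg {X : ι → Subgroup G} (hX : CommRel P X) :
    CommRel P fun γ => X (neg P γ) := by
  intro α β h x hx y hy
  have h1 := hX _ _ (fun c hc h' => h c hc (by simpa using h')) x hx y hy
  refine (iSup₂_le fun γ hγ => ?_ :
    ⨆ γ ∈ openInterval P (neg P α) (neg P β), X γ ≤ _) h1
  obtain ⟨r, s, hr, hs, hγ⟩ := hγ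
  refine le_iSup₂_of_le (neg P γ) ⟨r, s, hr, hs, ?_⟩ (by simp)
  rw [root_neg, hγ]
  simp [add_comm]

section Compatible

variable (hν : IsCompatible φ o ν) {Δ : Set ι} (hΔ : IsBasis P Δ)
include hν hΔ

lemma conj_actKer_mem {t u : G} (ht : t ∈ actKer ν) {γ : ι} (hu : u ∈ rootGroupOn φ o Ω γ) :
    t * u * t⁻¹ ∈ rootGroupOn φ o Ω γ := by
  by_cases hu1 : u = 1
  · simp [hu1]
  obtain ⟨hT, hN, h1⟩ := mem_actKer.1 ht
  obtain ⟨k, hk⟩ := φ.exists_hasVal (mem_rootGroupOn.1 hu).1 hu1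
  have h2 := hasVal_conj_T hν hΔ hT hN hk
  rw [h1] at h2
  simp only [OneMemClass.coe_one, Equiv.Perm.coe_one, id_eq, vsub_self, map_zero, add_zero] at h2
  rw [h2.mem_rootGroupOn_iff]
  exact hk.mem_rootGroupOn_iff.1 hu

-- Fixing `y` and `z` fixes a vector of the open chamber, so `n` preserves the positive roots and
-- lies in `T`; with a fixed point, it acts trivially.
omit hΔ in
lemma mem_actKer_of_fix [Finite ι] [P.IsRootSystem] {Δ : Set ι} (hΔ : IsBasis P Δ) {y z : A}
    (hyz : z -ᵥ y ∈ chamber P R Δ) {n : G} (h : n ∈ D.N) (hy : (ν ⟨n, h⟩ : Equiv.Perm A) y = y)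
    (hz : (ν ⟨n, h⟩ : Equiv.Perm A) z = z) : n ∈ actKer ν := by
  obtain ⟨w, hw⟩ := exists_lift h
  have hT : n ∈ D.T := by
    refine mem_T_of_mem_lifts hΔ hw fun γ hγ => ?_
    have h1 := rootMap_nu hν hw h γ z y
    simp only [hy, hz] at h1
    have h2 := rootMap_pos_of_mem_posRoots hγ hyz
    by_contra hn
    have h3 := rootMap_pos_of_mem_posRoots (hΔ.neg_mem_iff.2 hn) hyz
    rw [rootMap_neg, h1] at h3
    exact lt_asymm h2 (neg_pos.1 h3)
  refine mem_actKer.2 ⟨hT, h, nu_eq_one hν hT h (x := y) fun γ => ?_⟩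
  rw [hy, vsub_self, map_zero]

/-! ### Parahoric subgroups of sets with two points in regular position. -/

section Regular

variable [Finite ι] [P.IsRootSystem] {y z : A} (hy : y ∈ Ω) (hz : z ∈ Ω)
  (hyz : ∀ γ, rootMap P R γ (z -ᵥ y) ≠ 0)
include hy hz hyz

lemma exists_mul_eq_rootGroupOn {α : Δ} {u v : G} (hu : u ∈ rootGroupOn φ o Ω (α : ι))
    (hv : v ∈ rootGroupOn φ o Ω (neg P α)) : ∃ v' ∈ rootGroupOn φ o Ω (neg P α),
      ∃ t ∈ actKer ν, ∃ u' ∈ rootGroupOn φ o Ω (α : ι), u * v = v' * t * u' := by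
  by_cases hu1 : u = 1
  · exact ⟨v, hv, 1, one_mem _, 1, one_mem _, by simp [hu1]⟩
  by_cases hv1 : v = 1
  · exact ⟨1, one_mem _, 1, one_mem _, u, hu, by simp [hv1]⟩
  obtain ⟨k, hk⟩ := φ.exists_hasVal (mem_rootGroupOn.1 hu).1 hu1
  obtain ⟨l, hl⟩ := φ.exists_hasVal (mem_rootGroupOn.1 hv).1 hv1
  rw [hk.mem_rootGroupOn_iff] at hu
  rw [hl.mem_rootGroupOn_iff] at hv
  simp only [rootAt_neg, _root_.neg_neg] at hv
  -- The bounds give `k + l ≥ α(q) - α(p)` for all `p, q ∈ Ω`. As `α(y) ≠ α(z)`, one order of `y`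
  -- and `z` makes this positive.
  have hkl : 0 < k + l := by
    have h1 := hyz α
    rw [← rootAt_sub o] at h1
    rcases lt_or_gt_of_ne (sub_ne_zero.1 h1) with h2 | h2
    · have := add_le_add (hu z hz) (hv y hy)
      exact lt_of_lt_of_le (by rw [neg_add_eq_sub]; exact sub_pos.2 h2) this
    · have := add_le_add (hu y hy) (hv z hz)
      exact lt_of_lt_of_le (by rw [neg_add_eq_sub]; exact sub_pos.2 h2) this
  obtain ⟨v', hv', t, ht, h1, u', hu', he⟩ := exists_mul_eq hν hΔ hk hl hkl
  refine ⟨v', ?_, t, mem_actKer.2 ⟨ht, _, h1⟩, u', ?_, he⟩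
  · rw [hv'.mem_rootGroupOn_iff]
    simpa only [rootAt_neg, _root_.neg_neg] using hv
  · rwa [hu'.mem_rootGroupOn_iff]

/-- Split the `α`-part off the end of `a` and the `(-α)`-part off the start of `b`. These adjacent
factors are swapped by the rank-one lemma, and the resulting `s ∈ T_b` is pushed to the right. -/
lemma bigCell_reflection (α : Δ) {g : G}
    (hg : g ∈ bigCell (P := P) (rootGroupOn φ o Ω) (actKer ν) (posRoots P Δ)) :
    g ∈ bigCell (P := P) (rootGroupOn φ o Ω) (actKer ν)
      (posRoots P (P.reflectionPerm α '' Δ)) := by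
  obtain ⟨a, ha, b, hb, t, ht, rfl⟩ := hg
  have hX := commRel_rootGroupOn φ o Ω
  obtain ⟨a', ha', x, hx, he⟩ := exists_mul_of_mem_biSup hΔ hX α
    (fun γ h => rootGroupOn_le_of_mem_ray h) (inv_mem ha)
  obtain ⟨b', hb', y, hy', rfl⟩ := exists_mul_of_mem_biSup hΔ hX.comp_neg α
    (fun γ h => rootGroupOn_le_of_mem_ray (neg_mem_ray h)) hb
  obtain ⟨y', hy'', s, hs, x', hx', he'⟩ :=
    exists_mul_eq_rootGroupOn hν hΔ hy hz hyz (inv_mem hx) hy'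
  have hmem : (posRoots P Δ \ ray P α) ⊆ posRoots P (P.reflectionPerm α '' Δ) := by
    rw [hΔ.posRoots_reflection]
    exact Set.subset_union_left
  have hneg : neg P α ∈ posRoots P (P.reflectionPerm α '' Δ) := by
    rw [hΔ.posRoots_reflection]
    exact Or.inr (by simpa using self_mem_ray P (α : ι))
  have hmono (X : ι → Subgroup G) : ⨆ γ ∈ posRoots P Δ \ ray P α, X γ ≤
      ⨆ γ ∈ posRoots P (P.reflectionPerm α '' Δ), X γ := biSup_mono fun _ h => hmem h
  refine ⟨a'⁻¹ * y', mul_mem (hmono _ (inv_mem ha')) (mem_biSup hneg hy''),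
    (s * x' * s⁻¹) * (s * b' * s⁻¹), mul_mem ?_ ?_, s * t, mul_mem hs ht, ?_⟩
  · refine mem_biSup (X := fun γ => rootGroupOn φ o Ω (neg P γ)) hneg ?_
    rw [neg_neg_index]
    exact conj_actKer_mem hν hΔ hs hx'
  · exact conj_mem_of_mem_iSup (fun γ hγ u hu => mem_biSup
      (X := fun γ => rootGroupOn φ o Ω (neg P γ)) (hmem hγ) (conj_actKer_mem hν hΔ hs hu)) hb'
  · have h1 : a = a'⁻¹ * x⁻¹ := by rw [← mul_inv_rev, ← he, inv_inv]
    rw [h1, show a'⁻¹ * x⁻¹ * (y * b') * t = a'⁻¹ * (x⁻¹ * y) * b' * t by group, he']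
    group

lemma mem_bigCell_of_mem {Δ' : Set ι} (hΔ' : IsBasis P Δ') {g : G}
    (hg : g ∈ bigCell (P := P) (rootGroupOn φ o Ω) (actKer ν) (posRoots P Δ)) :
    g ∈ bigCell (P := P) (rootGroupOn φ o Ω) (actKer ν) (posRoots P Δ') :=
  hΔ.gallery (fun S => g ∈ bigCell (P := P) (rootGroupOn φ o Ω) (actKer ν) S)
    (fun _ hΔ α hα h => bigCell_reflection hν hΔ hy hz hyz ⟨α, hα⟩ h) hΔ' hg

lemma mul_mem_bigCell {x g : G} (hx : (∃ γ, x ∈ rootGroupOn φ o Ω γ) ∨ x ∈ actKer ν)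
    (hg : g ∈ bigCell (P := P) (rootGroupOn φ o Ω) (actKer ν) (posRoots P Δ)) :
    x * g ∈ bigCell (P := P) (rootGroupOn φ o Ω) (actKer ν) (posRoots P Δ) := by
  have key {Δ : Set ι} {γ : ι} (hγ : γ ∈ posRoots P Δ) {g : G} (hx : x ∈ rootGroupOn φ o Ω γ)
      (hg : g ∈ bigCell (P := P) (rootGroupOn φ o Ω) (actKer ν) (posRoots P Δ)) :
      x * g ∈ bigCell (P := P) (rootGroupOn φ o Ω) (actKer ν) (posRoots P Δ) := by
    obtain ⟨a, ha, b, hb, t, ht, rfl⟩ := hg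
    exact ⟨x * a, mul_mem (mem_biSup hγ hx) ha, b, hb, t, ht, by group⟩
  rcases hx with ⟨γ, hx⟩ | hx
  · rcases hΔ.mem_or_neg γ with hγ | hγ
    · exact key hγ hx hg
    -- For a negative root, pass to `-Δ`, absorb `x` in the leading factor there, and come back.
    · have hΔ' := (isAut_negPerm P).isBasis_image hΔ
      refine mem_bigCell_of_mem hν hΔ' hy hz hyz hΔ (key ?_ hx
        (mem_bigCell_of_mem hν hΔ hy hz hyz hΔ' hg))
      rw [← (isAut_negPerm P).mem_posRoots_image] at hγ
      simpa using hγ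
  · obtain ⟨a, ha, b, hb, t, ht, rfl⟩ := hg
    refine ⟨x * a * x⁻¹, ?_, x * b * x⁻¹, ?_, x * t, mul_mem hx ht, by group⟩
    · exact conj_mem_of_mem_iSup (fun γ hγ u hu => mem_biSup hγ (conj_actKer_mem hν hΔ hx hu)) ha
    · exact conj_mem_of_mem_iSup (fun γ hγ u hu => mem_biSup
        (X := fun γ => rootGroupOn φ o Ω (neg P γ)) hγ (conj_actKer_mem hν hΔ hx hu)) hb

/-- The parahoric subgroup of a set that contains two points whose difference is regular is
`U_Ω⁺ U_Ω⁻ T_b`, for every choice of the positive roots. -/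
theorem mem_bigCell_of_mem_parahoric (hfix : fixator ν Ω ⊆ actKer ν) {g : G}
    (hg : g ∈ parahoric φ o ν Ω) :
    g ∈ bigCell (P := P) (rootGroupOn φ o Ω) (actKer ν) (posRoots P Δ) := by
  have h1 : parahoric φ o ν Ω ≤
      Subgroup.closure ({x | ∃ γ, x ∈ rootGroupOn φ o Ω γ} ∪ actKer ν) := by
    refine (Subgroup.closure_le _).2 (Set.union_subset ?_ ?_)
    · refine (Subgroup.closure_le _).2 ?_
      rintro g ⟨γ, h, h'⟩
      exact Subgroup.subset_closure (Or.inl ⟨γ, mem_rootGroupOn_of_le h h'⟩)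
    · exact fun g hg => Subgroup.subset_closure (Or.inr (hfix hg))
  have h2 := h1 hg
  clear hg
  induction h2 using Subgroup.closure_induction_left with
  | one => exact ⟨1, one_mem _, 1, one_mem _, 1, one_mem _, by simp⟩
  | mul_left x hx y _ ih => exact mul_mem_bigCell hν hΔ hy hz hyz hx ih
  | inv_mul_cancel x hx y _ ih =>
    refine mul_mem_bigCell hν hΔ hy hz hyz ?_ ih
    exact hx.imp (fun ⟨γ, h⟩ => ⟨γ, inv_mem h⟩) (fun h => inv_mem h)

/-- An element of `U_Δ n ∩ P̂_Ω`, with `n ∈ N`, exists only if `n` acts trivially. -/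
theorem mem_actKer_of_mul_mem_parahoric (hfix : fixator ν Ω ⊆ actKer ν) {u n : G}
    (hu : u ∈ ⨆ γ ∈ posRoots P Δ, D.U γ) (hn : n ∈ D.N) (h : u * n ∈ parahoric φ o ν Ω) :
    n ∈ actKer ν := by
  obtain ⟨a, ha, b, hb, t, ht, he⟩ :=
    mem_bigCell_of_mem_parahoric hν hΔ hy hz hyz hfix h
  have hle (γ : ι) : rootGroupOn φ o Ω γ ≤ D.U γ := fun g hg => (mem_rootGroupOn.1 hg).1
  have ha' : a ∈ ⨆ γ ∈ posRoots P Δ, D.U γ := (iSup₂_mono fun γ _ => hle γ : _ ≤ _) ha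
  have hb' : b ∈ ⨆ γ ∈ posRoots P Δ, D.U (neg P γ) :=
    (iSup₂_mono fun γ _ => hle (neg P γ) : _ ≤ _) hb
  have h1 : n * t⁻¹ = u⁻¹ * a * b := by
    have : n = u⁻¹ * (a * b * t) := by rw [← he]; group
    rw [this]
    group
  have h2 := eq_one_of_eq_mul hΔ (mul_mem hn (inv_mem (mem_actKer.1 ht).2.1))
    (mul_mem (inv_mem hu) ha') hb' h1
  rwa [mul_inv_eq_one.1 h2]

end Regular

end Compatible

end RootGroupDatum

end Parahoric

/-! ### The Iwasawa decomposition -/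

section Decomposition

variable {ι : Type u₁} {M : Type u₂} {V : Type u₃}
  [AddCommGroup M] [Module ℝ M] [AddCommGroup V] [Module ℝ V] {P : RootPairing ι ℝ M V}
  [P.IsCrystallographic]

namespace RootGroupDatum

open Iwasawa.RootGroupDatum.Valuation

variable {G : Type u₆} [Group G] {D : RootGroupDatum P G}
  {R : Type u₄} [AddCommGroup R] [LinearOrder R]
  {A : Type u₅} [AddTorsor (VR P R) A]
  {φ : D.Valuation R} {o : A} {ν : D.N →* affGroup P R A}

omit [P.IsCrystallographic] in
-- For trivial `R`, a valuation takes at most the two values `0` and `∞`.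
lemma isEmpty_or_nontrivial (φ : D.Valuation R) : IsEmpty ι ∨ Nontrivial R := by
  rcases isEmpty_or_nonempty ι with h | ⟨⟨α⟩⟩
  · exact Or.inl h
  · right
    by_contra hn
    rw [not_nontrivial_iff_subsingleton] at hn
    have h1 : Set.range (φ.φ α) ⊆ {⊤, ((0 : R) : WithTop R)} := by
      rintro _ ⟨u, rfl⟩
      induction φ.φ α u with
      | top => exact Or.inl rfl
      | coe r => exact Or.inr (congrArg _ (Subsingleton.elim r 0))
    have h2 : (3 : ℕ∞) ≤ 2 := by
      refine (φ.three_le α).trans ((Set.encard_le_encard h1).trans ?_)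
      rw [Set.encard_pair WithTop.top_ne_coe]
    exact absurd h2 (by norm_num)

lemma mem_parahoricFilter {F : Filter A} {g : G} :
    g ∈ parahoricFilter φ o ν F ↔ ∃ Ω ∈ F, g ∈ parahoric φ o ν Ω := by
  change g ∈ (⋃ Ω ∈ F, (parahoric φ o ν Ω : Set G)) ↔ _
  simp

lemma halfSpace_mem_germ {γ : ι} {r : R} {x : A} {C : Set (VR P R)}
    (h : 0 < rootAt P R o γ x + r) : {z | 0 < rootAt P R o γ z + r} ∈ germ P R o x C :=
  letI := apartmentTopology P R o
  have ho : IsOpen {z | 0 < rootAt P R o γ z + r} :=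
    TopologicalSpace.isOpen_generateFrom_of_mem ⟨γ, r, rfl⟩
  Filter.mem_inf_of_left (ho.mem_nhds h)

lemma cone_mem_germ (o x : A) (C : Set (VR P R)) :
    ((fun v => v +ᵥ x) '' C) ∈ germ P R o x C :=
  Filter.mem_inf_of_right (Filter.mem_principal_self _)

variable [IsOrderedAddMonoid R]

/-- A strict inequality at `x` persists on a neighbourhood of `x`, whatever the sign of `γ` on `C`.
-/
lemma mem_parahoricFilter_of_lt {γ : ι} {u : G} {k : R} {x : A} {C : Set (VR P R)}
    (hu : φ.HasVal γ u k) (h : -rootAt P R o γ x < k) :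
    u ∈ parahoricFilter φ o ν (germ P R o x C) := by
  refine mem_parahoricFilter.2 ⟨_, halfSpace_mem_germ (γ := γ) (r := k)
    (neg_lt_iff_pos_add'.1 h), rootGroupOn_le_parahoric γ ?_⟩
  rw [hu.mem_rootGroupOn_iff]
  exact fun z hz => (neg_lt_iff_pos_add'.2 hz).le

/-- Equality at `x` is allowed here, because a positive root only grows from `x` into `x + C`. -/
lemma mem_parahoricFilter_of_le [Finite ι] {Δ : Set ι} {γ : ι} (hγ : γ ∈ posRoots P Δ) {u : G}
    {k : R} {x : A} (hu : φ.HasVal γ u k) (h : -rootAt P R o γ x ≤ k) :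
    u ∈ parahoricFilter φ o ν (germ P R o x (chamber P R Δ)) := by
  refine mem_parahoricFilter.2 ⟨_, cone_mem_germ o x _, rootGroupOn_le_parahoric γ ?_⟩
  rw [hu.mem_rootGroupOn_iff]
  rintro _ ⟨v, hv, rfl⟩
  rw [rootAt_vadd]
  refine le_trans (neg_le_neg ?_) h
  exact le_add_of_nonneg_left (rootMap_pos_of_mem_posRoots hγ hv).le

/-- The Iwasawa decomposition in rank one. -/
lemma mem_parahoricFilter_or [Finite ι] {Δ : Set ι} (hΔ : IsBasis P Δ) (x : A) {β : ι} {y : G}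
    (hy : y ∈ D.U β) : y ∈ parahoricFilter φ o ν (germ P R o x (chamber P R Δ)) ∨
      ∃ a ∈ D.U (neg P β), ∃ m ∈ D.M β, ∃ b,
        b ∈ parahoricFilter φ o ν (germ P R o x (chamber P R Δ)) ∧ y = a * m * b := by
  by_cases hy1 : y = 1
  · exact Or.inl (hy1 ▸ one_mem _)
  obtain ⟨k, hk⟩ := φ.exists_hasVal hy hy1
  obtain ⟨a, ha, m, hm, b, hb, rfl⟩ := exists_eq_mul' hy hy1
  rw [M_neg D hΔ] at hm
  have hb' := (hk.left_right ha hb hm (inv_mem_M hΔ hm)).2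
  have hneg (h : k < -rootAt P R o β x) : -rootAt P R o (neg P β) x < -k := by
    rwa [rootAt_neg, neg_lt_neg_iff]
  -- Of `β` and `-β`, the one positive on the chamber gets the weak inequality and the other the
  -- strict one, so that the two cases are exhaustive.
  rcases hΔ.mem_or_neg β with hβ | hβ
  · rcases le_or_gt (-rootAt P R o β x) k with h | h
    · exact Or.inl (mem_parahoricFilter_of_le hβ hk h)
    · exact Or.inr ⟨a, ha, m, hm, b, mem_parahoricFilter_of_lt hb' (hneg h), rfl⟩
  · rcases lt_or_ge (-rootAt P R o β x) k with h | h
    · exact Or.inl (mem_parahoricFilter_of_lt hk h)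
    · refine Or.inr ⟨a, ha, m, hm, b, mem_parahoricFilter_of_le hβ hb' ?_, rfl⟩
      rwa [rootAt_neg, neg_le_neg_iff]

omit [P.IsCrystallographic] in
/-- The product `U⁺ N Q`, where the positive roots form the set `S`. -/
def iwasawaCell (D : RootGroupDatum P G) (Q : Subgroup G) (S : Set ι) : Set G :=
  {g | ∃ a ∈ ⨆ γ ∈ S, D.U γ, ∃ n ∈ D.N, ∃ p ∈ Q, g = a * n * p}

/-- The `U_α` factor, moved to the right of `n`, is an element of `U_{w⁻¹α}`. It is absorbed in the
parahoric subgroup, or its `U_{-w⁻¹α}` part returns across `n` into `U_{-α}`, which is positive for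
`r_α Δ`. -/
lemma iwasawaCell_reflection [Finite ι] {Δ₀ : Set ι} (hΔ₀ : IsBasis P Δ₀) (x : A) {Δ : Set ι}
    (hΔ : IsBasis P Δ) (α : Δ) {g : G} (hg : g ∈ iwasawaCell D
      (parahoricFilter φ o ν (germ P R o x (chamber P R Δ₀))) (posRoots P Δ)) :
    g ∈ iwasawaCell D (parahoricFilter φ o ν (germ P R o x (chamber P R Δ₀)))
      (posRoots P (P.reflectionPerm α '' Δ)) := by
  obtain ⟨a, ha, n, hn, p, hp, rfl⟩ := hg
  obtain ⟨a', ha', u, hu, he⟩ := exists_mul_of_mem_biSup hΔ (commRel_U D) α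
    (fun γ h => U_le_of_mem_ray h) (inv_mem ha)
  have hmono : ⨆ γ ∈ posRoots P Δ \ ray P α, D.U γ ≤
      ⨆ γ ∈ posRoots P (P.reflectionPerm α '' Δ), D.U γ := by
    rw [hΔ.posRoots_reflection]
    exact biSup_mono fun _ h => Or.inl h
  have hneg : neg P α ∈ posRoots P (P.reflectionPerm α '' Δ) := by
    rw [hΔ.posRoots_reflection]
    exact Or.inr (by simpa using self_mem_ray P (α : ι))
  have h1 : a = a'⁻¹ * u⁻¹ := by rw [← mul_inv_rev, ← he, inv_inv]
  obtain ⟨w, hw⟩ := exists_lift hn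
  have hA := acts_of_mem_lifts hw
  have hu' : n⁻¹ * u⁻¹ * n ∈ D.U (w⁻¹ (α : ι)) := by simpa using hA.inv.mem (inv_mem hu)
  rcases mem_parahoricFilter_or (φ := φ) (o := o) (ν := ν) hΔ₀ x hu' with
    h | ⟨b, hb, m, hm, c, hc, hbc⟩
  · refine ⟨a'⁻¹, hmono (inv_mem ha'), n, hn, n⁻¹ * u⁻¹ * n * p, mul_mem h hp, ?_⟩
    rw [h1]
    group
  · have hb' := hA.mem hb
    rw [(isAut_of_mem_lifts hw).neg_apply] at hb'
    rw [show w (w⁻¹ (α : ι)) = α by simp] at hb'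
    refine ⟨a'⁻¹ * (n * b * n⁻¹), mul_mem (hmono (inv_mem ha')) (mem_biSup hneg hb'), n * m,
      mul_mem hn (D.mem_N hm), c * p, mul_mem hc hp, ?_⟩
    have h2 : u⁻¹ = n * (b * m * c) * n⁻¹ := by rw [← hbc]; group
    rw [h1, h2]
    group

/-- `G = U_Δ N P̂_F`. -/
theorem mem_iwasawaCell [Finite ι] (hD : D.IsGenerating) {Δ₀ : Set ι} (hΔ₀ : IsBasis P Δ₀) (x : A)
    {Δ : Set ι} (hΔ : IsBasis P Δ) (g : G) : g ∈ iwasawaCell D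
      (parahoricFilter φ o ν (germ P R o x (chamber P R Δ₀))) (posRoots P Δ) := by
  set Q := parahoricFilter φ o ν (germ P R o x (chamber P R Δ₀)) with hQ
  have hU {γ : ι} {y g : G} (hy : y ∈ D.U γ) (hg : g ∈ iwasawaCell D Q (posRoots P Δ)) :
      y * g ∈ iwasawaCell D Q (posRoots P Δ) := by
    have key {Δ : Set ι} (hγ : γ ∈ posRoots P Δ) {g : G}
        (hg : g ∈ iwasawaCell D Q (posRoots P Δ)) : y * g ∈ iwasawaCell D Q (posRoots P Δ) := by
      obtain ⟨a, ha, n, hn, p, hp, rfl⟩ := hg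
      exact ⟨y * a, mul_mem (mem_biSup hγ hy) ha, n, hn, p, hp, by group⟩
    have hgal {Δ Δ' : Set ι} (hΔ : IsBasis P Δ) (hΔ' : IsBasis P Δ') {g : G}
        (hg : g ∈ iwasawaCell D Q (posRoots P Δ)) : g ∈ iwasawaCell D Q (posRoots P Δ') :=
      hΔ.gallery (fun S => g ∈ iwasawaCell D Q S)
        (fun _ hΔ α hα h => iwasawaCell_reflection hΔ₀ x hΔ ⟨α, hα⟩ h) hΔ' hg
    rcases hΔ.mem_or_neg γ with hγ | hγ
    · exact key hγ hg
    · have hΔ' := (isAut_negPerm P).isBasis_image hΔ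
      refine hgal hΔ' hΔ (key ?_ (hgal hΔ hΔ' hg))
      rw [← (isAut_negPerm P).mem_posRoots_image] at hγ
      simpa using hγ
  have hT {t g : G} (ht : t ∈ D.T) (hg : g ∈ iwasawaCell D Q (posRoots P Δ)) :
      t * g ∈ iwasawaCell D Q (posRoots P Δ) := by
    obtain ⟨a, ha, n, hn, p, hp, rfl⟩ := hg
    exact ⟨t * a * t⁻¹, conj_mem_of_mem_iSup (fun γ hγ u hu => mem_biSup hγ (conj_T_mem ht hu)) ha,
      t * n, mul_mem (mem_N_of_mem_T ht) hn, p, hp, by group⟩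
  have hg : g ∈ Subgroup.closure ((D.T : Set G) ∪ ⋃ α, (D.U α : Set G)) := by
    rw [show Subgroup.closure ((D.T : Set G) ∪ ⋃ α, (D.U α : Set G)) = ⊤ from hD]
    exact Subgroup.mem_top g
  induction hg using Subgroup.closure_induction_left with
  | one => exact ⟨1, one_mem _, 1, one_mem _, 1, one_mem _, by simp⟩
  | mul_left y hy z _ ih =>
    rcases hy with hy | hy
    · exact hT hy ih
    · obtain ⟨α, hy⟩ := Set.mem_iUnion.1 hy
      exact hU hy ih
  | inv_mul_cancel y hy z _ ih =>
    rcases hy with hy | hy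
    · exact hT (inv_mem hy) ih
    · obtain ⟨α, hy⟩ := Set.mem_iUnion.1 hy
      exact hU (inv_mem hy) ih

/-- If `U_Δ n` meets `P̂_F`, then `n` acts trivially. -/
theorem mem_actKer_of_mul_mem [Finite ι] [P.IsRootSystem] [Module ℚ R]
    (hν : IsCompatible φ o ν) {Δ₀ : Set ι}
    (hΔ₀ : IsBasis P Δ₀) {x : A} {Δ : Set ι} (hΔ : IsBasis P Δ) {u n : G}
    (hu : u ∈ ⨆ γ ∈ posRoots P Δ, D.U γ) (hn : n ∈ D.N)
    (h : u * n ∈ parahoricFilter φ o ν (germ P R o x (chamber P R Δ₀))) : n ∈ actKer ν := by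
  obtain ⟨Ω, hΩ, h⟩ := mem_parahoricFilter.1 h
  obtain ⟨y, hy, z, hz, hyz⟩ := exists_mem_germ (isEmpty_or_nontrivial φ) hΔ₀ o x hΩ
  refine mem_actKer_of_mul_mem_parahoric hν hΔ hy hz (fun γ => ?_) ?_ hu hn h
  · rcases hΔ₀.mem_or_neg γ with hγ | hγ
    · exact (rootMap_pos_of_mem_posRoots hγ hyz).ne'
    · have := rootMap_pos_of_mem_posRoots hγ hyz
      rw [rootMap_neg] at this
      exact (neg_pos.1 this).ne
  · rintro g ⟨hg, hfix⟩
    exact mem_actKer_of_fix hν hΔ₀ hyz hg (hfix y hy) (hfix z hz)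

/-- The elements `n` and `n'` of `N` have the same double coset if and only if they have the same
image in the affine Weyl group. -/
theorem mk_eq_mk_iff [Finite ι] [P.IsRootSystem] [Module ℚ R]
    (hν : IsCompatible φ o ν) {Δ₀ : Set ι}
    (hΔ₀ : IsBasis P Δ₀) {x : A} {Δ : Set ι} (hΔ : IsBasis P Δ) (n n' : D.N) :
    DoubleCoset.mk (⨆ γ ∈ posRoots P Δ, D.U γ)
      (parahoricFilter φ o ν (germ P R o x (chamber P R Δ₀))) (n : G) =
    DoubleCoset.mk _ (parahoricFilter φ o ν (germ P R o x (chamber P R Δ₀))) (n' : G) ↔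
      n⁻¹ * n' ∈ ν.ker := by
  rw [DoubleCoset.eq]
  constructor
  · rintro ⟨u, hu, p, hp, h⟩
    obtain ⟨w, hw⟩ := exists_lift (inv_mem n.2)
    have hw' := isAut_of_mem_lifts hw
    have hA := acts_of_mem_lifts hw
    -- Conjugating by `n⁻¹` replaces `Δ` by `w Δ`; this is why the preceding theorem must allow a
    -- basis unrelated to `Δ₀`.
    have h1 : (n : G)⁻¹ * u * n ∈ ⨆ γ ∈ posRoots P (w '' Δ), D.U γ := by
      rw [hw'.posRoots_image]
      have := conj_mem_of_mem_iSup (n := (n : G)⁻¹) (K := ⨆ γ ∈ w '' posRoots P Δ, D.U γ)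
        (fun γ hγ v hv => mem_biSup (Set.mem_image_of_mem w hγ) (hA.mem hv)) hu
      simpa using this
    have h2 : ((n : G)⁻¹ * u * n)⁻¹ * ((n : G)⁻¹ * n') = p := by
      rw [h]
      group
    have h3 := mem_actKer_of_mul_mem hν hΔ₀ (x := x) (hw'.isBasis_image hΔ) (inv_mem h1)
      (mul_mem (inv_mem n.2) n'.2) (h2 ▸ hp)
    obtain ⟨-, h4, h5⟩ := mem_actKer.1 h3
    exact h5
  · intro h
    refine ⟨1, one_mem _, (n : G)⁻¹ * n', mem_parahoricFilter.2 ⟨Set.univ, Filter.univ_mem,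
      Subgroup.subset_closure (Or.inr ⟨(n⁻¹ * n').2, fun y _ => ?_⟩)⟩, by group⟩
    rw [show (⟨(n : G)⁻¹ * n', (n⁻¹ * n').2⟩ : D.N) = n⁻¹ * n' from rfl, MonoidHom.mem_ker.1 h]
    rfl

end RootGroupDatum

end Decomposition

end Iwasawa

end

theorem mainTheorem2 {ι M V R G A : Type*}
    [Finite ι] [AddCommGroup M] [Module ℝ M] [AddCommGroup V] [Module ℝ V]
    (P : RootPairing ι ℝ M V) [P.IsRootSystem] [P.IsCrystallographic]
    [AddCommGroup R] [LinearOrder R] [IsOrderedAddMonoid R] [Module ℚ R]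
    [Group G] [AddTorsor (Iwasawa.VR P R) A]
    (D : Iwasawa.RootGroupDatum P G) (hD : D.IsGenerating)
    (φ : D.Valuation R) (o : A) (ν : D.N →* Iwasawa.affGroup P R A)
    (hν : Iwasawa.RootGroupDatum.IsCompatible φ o ν)
    (C C' : Set (Iwasawa.VR P R))
    (hC : Iwasawa.IsVectorChamber P R C) (hC' : Iwasawa.IsVectorChamber P R C') (x : A) :
    ((D.chamberGroup C' : Set G) * (D.N : Set G) *
        (Iwasawa.RootGroupDatum.parahoricFilter φ o ν (Iwasawa.germ P R o x C) : Set G)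
      = Set.univ) ∧
    (∃ ψ : (D.N ⧸ ν.ker) ≃ DoubleCoset.Quotient (D.chamberGroup C' : Set G)
        (Iwasawa.RootGroupDatum.parahoricFilter φ o ν (Iwasawa.germ P R o x C) : Set G),
      ∀ n : D.N, ψ (n : D.N ⧸ ν.ker) = DoubleCoset.mk _ _ (n : G)) ∧
    (∃ ψ : ν.range ≃ DoubleCoset.Quotient (D.chamberGroup C' : Set G)
        (Iwasawa.RootGroupDatum.parahoricFilter φ o ν (Iwasawa.germ P R o x C) : Set G),
      ∀ n : D.N, ψ ⟨ν n, n, rfl⟩ = DoubleCoset.mk _ _ (n : G)) := by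
  obtain ⟨Δ₀, hΔ₀, rfl⟩ := hC
  obtain ⟨Δ, hΔ, rfl⟩ := hC'
  have hU : D.chamberGroup (Iwasawa.chamber P R Δ) = ⨆ γ ∈ Iwasawa.posRoots P Δ, D.U γ := by
    rw [Iwasawa.RootGroupDatum.chamberGroup, hΔ.rootsPosOn_chamber
      (hΔ.chamber_nonempty (Iwasawa.RootGroupDatum.isEmpty_or_nontrivial φ))]
  rw [hU]
  have hcell := Iwasawa.RootGroupDatum.mem_iwasawaCell (φ := φ) (o := o) (ν := ν) hD hΔ₀ x hΔ
  have hmk := Iwasawa.RootGroupDatum.mk_eq_mk_iff hν hΔ₀ (x := x) hΔ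
  set Q := Iwasawa.RootGroupDatum.parahoricFilter φ o ν
    (Iwasawa.germ P R o x (Iwasawa.chamber P R Δ₀))
  set U : Subgroup G := ⨆ γ ∈ Iwasawa.posRoots P Δ, D.U γ
  have key : ∃ ψ : (D.N ⧸ ν.ker) ≃ DoubleCoset.Quotient (U : Set G) (Q : Set G),
      ∀ n : D.N, ψ (n : D.N ⧸ ν.ker) = DoubleCoset.mk _ _ (n : G) := by
    let f : (D.N ⧸ ν.ker) → DoubleCoset.Quotient (U : Set G) (Q : Set G) :=
      Quotient.lift (fun n : D.N => DoubleCoset.mk U Q (n : G))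
        fun n n' h => (hmk n n').2 (QuotientGroup.leftRel_apply.1 h)
    refine ⟨Equiv.ofBijective f ⟨?_, ?_⟩, fun n => rfl⟩
    · intro a b
      induction a using QuotientGroup.induction_on
      induction b using QuotientGroup.induction_on
      exact fun h => QuotientGroup.eq.2 ((hmk _ _).1 h)
    · intro q
      obtain ⟨g, rfl⟩ := Quotient.exists_rep q
      obtain ⟨a, ha, n, hn, p, hp, rfl⟩ := hcell g
      exact ⟨((⟨n, hn⟩ : D.N) : D.N ⧸ ν.ker), (DoubleCoset.eq U Q n _).2 ⟨a, ha, p, hp, rfl⟩⟩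
  refine ⟨?_, key, ?_⟩
  · refine Set.eq_univ_of_forall fun g => ?_
    obtain ⟨a, ha, n, hn, p, hp, rfl⟩ := hcell g
    exact Set.mul_mem_mul (Set.mul_mem_mul ha hn) hp
  · obtain ⟨ψ, hψ⟩ := key
    refine ⟨(QuotientGroup.quotientKerEquivRange ν).symm.toEquiv.trans ψ, fun n => ?_⟩
    rw [← hψ n, Equiv.trans_apply]
    congr 1
    exact (QuotientGroup.quotientKerEquivRange ν).symm_apply_eq.2 rfl
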